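/- Let $k\ge 1$ be an integer and $\mu\in\mathbb C$. Consider germs at the origin of analytic families of vector fields $X(x;\lambda)\frac{\partial}{\partial x}$, $x\in(\mathbb C,0)$, $\lambda\in(\mathbb C^m,0)$, $m\ge 0$, analytic jointly in $(x,\lambda)$. Such a family is a deformation of $X(x;0)\frac{\partial}{\partial x}$. Two deformations $X(x;\lambda)$ and $X'(x;\lambda)$ of the same germ $X(x;0)=X'(x;0)$, with the same parameter, are called equivalent if there is an analytic germ $\phi(x;\lambda)$ at $(0,0)$ with $\phi(x;0)\equiv x$ and $$\frac{\partial\phi}{\partial x}(x;\lambda)\,X(x;\lambda)=X'(\phi(x;\lambda);\lambda)$$ for $(x,\lambda)$ near $(0,0)$. Then the deformation $$X_3(x;y)\frac{\partial}{\partial x}=\frac{x^{k+1}+y_{k-1}x^{k-1}+\dots+y_1x+y_0}{1+(\mu+y_{2k+1})x^k}\,\frac{\partial}{\partial x},\qquad y=(y_0,\dots,y_{k-1},y_{2k+1})\in(\mathbb C^{k+1},0),$$ of $\frac{x^{k+1}}{1+\mu x^k}\frac{\partial}{\partial x}$ is universal. That is, for every $m$ and every analytic deformation $X(x;\lambda)\frac{\partial}{\partial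 x}$, $\lambda\in(\mathbb C^m,0)$, of $\frac{x^{k+1}}{1+\mu x^k}\frac{\partial}{\partial x}$: 1. (versality) there is a germ of an analytic map $\psi:(\mathbb C^m,0)\to(\mathbb C^{k+1},0)$ such that $X(x;\lambda)\frac{\partial}{\partial x}$ is equivalent to the induced deformation $X_3(x;\psi(\lambda))\frac{\partial}{\partial x}$; 2. (uniqueness) the germ $\psi$ with this property is unique. -/

import Mathlib

open Filter Topology

/-! A germ at `0` of a parametric family of vector fields `X(x; l) ∂/∂x` on `ℂ`, with parameter
`l` in a complex normed space `E`, is represented by its coefficient function `X : ℂ × E → ℂ`.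
All germs are taken at the origin: only values near `0` matter. -/

namespace VectorFieldGerm

/-- `X` is (a representative of) an analytic deformation of the germ of vector field `X₀ ∂/∂x`. -/
def IsDeformation {E : Type*} [NormedAddCommGroup E] [NormedSpace ℂ E]
    (X : ℂ × E → ℂ) (X₀ : ℂ → ℂ) : Prop :=
  AnalyticAt ℂ X 0 ∧ ∀ᶠ x in 𝓝 (0 : ℂ), X (x, 0) = X₀ x

/-- `φ` is a germ of an analytic invertible change of coordinate `x' = φ(x; l)` with `X = φ^* X'`.
Invertibility of `(x, l) ↦ (φ(x; l), l)` near the origin is the condition `∂φ/∂x (0; 0) ≠ 0`,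
and `X = φ^* X'` says `∂φ/∂x (x; l) * X (x; l) = X' (φ(x; l); l)`.
The point `φ(0; l)` may move with `l`. -/
structure IsConjugacy {E : Type*} [NormedAddCommGroup E] [NormedSpace ℂ E]
    (φ X X' : ℂ × E → ℂ) : Prop where
  analyticAt : AnalyticAt ℂ φ 0
  map_zero : φ 0 = 0
  deriv_ne_zero : deriv (fun x : ℂ => φ (x, 0)) 0 ≠ 0
  pullback_eq : ∀ᶠ p in 𝓝 (0 : ℂ × E),
    deriv (fun x : ℂ => φ (x, p.2)) p.1 * X p = X' (φ p, p.2)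

/-- Equivalence of deformations with the same parameter: they are conjugate by a change of
coordinate which is the identity for the parameter value `0`. -/
def AreEquivalent {E : Type*} [NormedAddCommGroup E] [NormedSpace ℂ E]
    (X X' : ℂ × E → ℂ) : Prop :=
  ∃ φ : ℂ × E → ℂ, IsConjugacy φ X X' ∧ ∀ᶠ x in 𝓝 (0 : ℂ), φ (x, 0) = x

/-- The family `X'(x; ψ(l))` induced from `X'` by the map `ψ`. -/
def induced {E F : Type*} (X' : ℂ × F → ℂ) (ψ : E → F) : ℂ × E → ℂ :=
  fun p => X' (p.1, ψ p.2)

/-- `ψ` is a germ of an analytic map `(E, 0) → (F, 0)` such that `X` is equivalent to the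
family induced from `X'` by `ψ`. -/
def IsInducingMap {E F : Type*} [NormedAddCommGroup E] [NormedSpace ℂ E]
    [NormedAddCommGroup F] [NormedSpace ℂ F]
    (X : ℂ × E → ℂ) (X' : ℂ × F → ℂ) (ψ : E → F) : Prop :=
  AnalyticAt ℂ ψ 0 ∧ ψ 0 = 0 ∧ AreEquivalent X (induced X' ψ)

/-- `X'` is a versal deformation of `X₀`: every analytic deformation of `X₀`, with any finite
number `m` of parameters, is equivalent to one induced from `X'`. -/
def IsVersal {F : Type*} [NormedAddCommGroup F] [NormedSpace ℂ F]
    (X' : ℂ × F → ℂ) (X₀ : ℂ → ℂ) : Prop :=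
  IsDeformation X' X₀ ∧
    ∀ (m : ℕ) (X : ℂ × (Fin m → ℂ) → ℂ), IsDeformation X X₀ →
      ∃ ψ : (Fin m → ℂ) → F, IsInducingMap X X' ψ

/-- `X'` is a universal deformation of `X₀`: it is versal, and the germ at `0` of the inducing map
is unique. -/
def IsUniversal {F : Type*} [NormedAddCommGroup F] [NormedSpace ℂ F]
    (X' : ℂ × F → ℂ) (X₀ : ℂ → ℂ) : Prop :=
  IsVersal X' X₀ ∧
    ∀ (m : ℕ) (X : ℂ × (Fin m → ℂ) → ℂ), IsDeformation X X₀ →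
      ∀ ψ₁ ψ₂ : (Fin m → ℂ) → F, IsInducingMap X X' ψ₁ → IsInducingMap X X' ψ₂ →
        ψ₁ =ᶠ[𝓝 0] ψ₂

/-- The parabolic normal form `x^(k+1) / (1 + μ x^k)`. -/
noncomputable def parabolic (k : ℕ) (μ : ℂ) : ℂ → ℂ :=
  fun x => x ^ (k + 1) / (1 + μ * x ^ k)

/-- The family `(x^(k+1) + y_{k-1} x^(k-1) + ⋯ + y_1 x + y_0) / (1 + (μ + y_{2k+1}) x^k)`.
The parameter is `y = ((y_0, …, y_{k-1}), y_{2k+1})`. -/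
noncomputable def kostovFamily (k : ℕ) (μ : ℂ) : ℂ × ((Fin k → ℂ) × ℂ) → ℂ :=
  fun p => (p.1 ^ (k + 1) + ∑ j : Fin k, p.2.1 j * p.1 ^ (j : ℕ)) /
    (1 + (μ + p.2.2) * p.1 ^ k)

end VectorFieldGerm

/-!
The theorem is an application of the inverse function theorem in a Banach algebra of functions of
`x`; the parameter `l` of a deformation enters only through the point `X(·; l)` of this algebra.

Let `A` be the algebra `SummableSeries r` of power series `f` with `∑ ‖fₙ‖ rⁿ < ∞`. A deformation
`X(x; l)` is the same as a germ of an analytic map `l ↦ X(·; l)` to `A`, for `r` small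
(`exists_analyticAt_eval_eq`). Write `X₃` for `kostovFamily k μ` and `X₀` for `parabolic k μ`.
Multiplied by its denominator, the equation `φ' X = X₃(φ; y)` reads
`(1 + (μ + y_{2k+1}) φ^k) φ' X = φ^{k+1} + ∑ yⱼ φ^j`. With `φ = x + c + ∫ g` it is polynomial in
the unknowns `(c, g, y)` and in `X ∈ A`, without loss of derivatives (`conjEq`).

At `φ = x`, `y = 0`, `X = X₀` put `ξ = c + ∫ g`, `w = 1 + μ x^k` and `ζ = w ξ`. Since
`X₀ ξ' - X₀' ξ = X₀² (ξ / X₀)'`, the linearized equation times `w` is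
`x^k (x ζ' - (k+1) ζ + y_{2k+1} x^{k+1}) - w ∑ yⱼ x^j`
(`denom_mul_conjEqDeriv`). The Euler operator `x d/dx - (k+1)` is diagonal on monomials, so that
the linearized equation is surjective with a kernel of dimension one, spanned by `ζ = x^{k+1}`, that
is by `ξ = X₀`. Prescribing the coefficient of `x^{k+1}` in `ζ` (`normalization`) makes it
bijective, and the inverse function theorem describes all solutions near the identity by the analytic
functions of `X` and of the value `t` of the normalization (`exists_analytic_solution`).
Taking `t = 0` gives versality.

For uniqueness, the parameters `y` of the solution must not depend on `t`. At any solution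
the field `η = φ' X = X₃(φ; y)` satisfies the linearized equation with constant parameters
(`exists_symmetry`), as it is the velocity of the flow of `X` composed with `φ`. By bijectivity the
derivative of the solution with respect to `t` is a multiple of `η`, hence `∂y/∂t = 0`. Any
equivalence which is the identity for `l = 0` is a solution close to the identity when `l` is
small, so its parameters are determined by `X(·; l)`.
-/

/-! ### The Banach algebra of power series converging absolutely on a closed disc -/

namespace VectorFieldGerm

open PowerSeries in
/-- The algebra of power series `∑ aₙ xⁿ` with `∑ ‖aₙ‖ rⁿ < ∞`, a Banach algebra of functions
on the closed disc of radius `r`. -/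
def SummableSeries (r : ℝ) [hr : Fact (0 < r)] : Subalgebra ℂ (PowerSeries ℂ) where
  carrier := {f | Summable fun n => ‖coeff n f‖ * r ^ n}
  mul_mem' {f g} hf hg := by
    have key := summable_norm_sum_mul_antidiagonal_of_summable_norm
      (f := fun n => coeff n f * (r : ℂ) ^ n) (g := fun n => coeff n g * (r : ℂ) ^ n)
      (by simpa [abs_of_pos hr.out] using hf) (by simpa [abs_of_pos hr.out] using hg)
    refine key.congr fun n => ?_
    have : ∑ kl ∈ Finset.HasAntidiagonal.antidiagonal n, coeff kl.1 f * (r : ℂ) ^ kl.1 *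
        (coeff kl.2 g * (r : ℂ) ^ kl.2) = coeff n (f * g) * (r : ℂ) ^ n := by
      rw [coeff_mul, Finset.sum_mul]
      refine Finset.sum_congr rfl fun p hp => ?_
      rw [← Finset.HasAntidiagonal.mem_antidiagonal.mp hp, pow_add]; ring
    rw [this]; simp [abs_of_pos hr.out]
  add_mem' {f g} hf hg := by
    refine Summable.of_nonneg_of_le (fun n => mul_nonneg (norm_nonneg _) (pow_nonneg hr.out.le _))
      (fun n => ?_) (hf.add hg)
    rw [← add_mul, map_add]
    exact mul_le_mul_of_nonneg_right (norm_add_le _ _) (pow_nonneg hr.out.le _)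
  algebraMap_mem' c := by
    refine summable_of_ne_finset_zero (s := {0}) fun n hn => ?_
    have hn' : n ≠ 0 := by simpa using hn
    simp [coeff_C, hn']

namespace SummableSeries

open PowerSeries (coeff)

variable {r : ℝ} [hr : Fact (0 < r)]

lemma summable (f : SummableSeries r) : Summable fun n => ‖coeff n (f : PowerSeries ℂ)‖ * r ^ n :=
  f.2

lemma term_nonneg (f : PowerSeries ℂ) (n : ℕ) : 0 ≤ ‖coeff n f‖ * r ^ n :=
  mul_nonneg (norm_nonneg _) (pow_nonneg hr.out.le _)

/-- The norm `∑ ‖aₙ‖ rⁿ`. -/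
noncomputable def ringNorm (r : ℝ) [hr : Fact (0 < r)] : RingNorm (SummableSeries r) where
  toFun f := ∑' n, ‖coeff n (f : PowerSeries ℂ)‖ * r ^ n
  map_zero' := by simp
  add_le' f g := by
    rw [← (summable f).tsum_add (summable g)]
    refine (summable (f + g)).tsum_le_tsum (fun n => ?_) ((summable f).add (summable g))
    rw [← add_mul]
    exact mul_le_mul_of_nonneg_right (by simpa using norm_add_le _ _) (pow_nonneg hr.out.le _)
  neg' f := by simp
  mul_le' f g := by
    have hf : Summable fun n => ‖‖coeff n (f : PowerSeries ℂ)‖ * r ^ n‖ :=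
      (summable f).congr fun n => (Real.norm_of_nonneg (term_nonneg _ n)).symm
    have hg : Summable fun n => ‖‖coeff n (g : PowerSeries ℂ)‖ * r ^ n‖ :=
      (summable g).congr fun n => (Real.norm_of_nonneg (term_nonneg _ n)).symm
    rw [tsum_mul_tsum_eq_tsum_sum_antidiagonal_of_summable_norm hf hg]
    refine (summable (f * g)).tsum_le_tsum (fun n => ?_)
      (summable_norm_sum_mul_antidiagonal_of_summable_norm hf hg).of_norm
    rw [Subalgebra.coe_mul, PowerSeries.coeff_mul]
    refine (mul_le_mul_of_nonneg_right (norm_sum_le _ _) (pow_nonneg hr.out.le _)).trans ?_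
    rw [Finset.sum_mul]
    refine Finset.sum_le_sum fun p hp => le_of_eq ?_
    rw [← Finset.HasAntidiagonal.mem_antidiagonal.mp hp, pow_add, norm_mul]; ring
  eq_zero_of_map_eq_zero' f hf := by
    have h := (hasSum_zero_iff_of_nonneg (fun n => term_nonneg (f : PowerSeries ℂ) n)).mp
      (by rw [← hf]; exact (summable f).hasSum)
    ext n
    have := congrFun h n
    simpa [hr.out.ne'] using this

noncomputable instance : NormedCommRing (SummableSeries r) :=
  { (ringNorm r).toNormedRing with mul_comm := mul_comm }

lemma norm_def (f : SummableSeries r) :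
    ‖f‖ = ∑' n, ‖coeff n (f : PowerSeries ℂ)‖ * r ^ n := rfl

noncomputable instance : NormedAlgebra ℂ (SummableSeries r) where
  __ := (inferInstance : Algebra ℂ (SummableSeries r))
  norm_smul_le c f := by
    simp only [norm_def]
    rw [← tsum_mul_left]
    exact le_of_eq (tsum_congr fun n => by simp [mul_assoc])

lemma norm_coeff_mul_le (f : SummableSeries r) (n : ℕ) :
    ‖coeff n (f : PowerSeries ℂ)‖ * r ^ n ≤ ‖f‖ :=
  (summable f).le_tsum n fun m _ => term_nonneg _ m

lemma mem_of_norm_coeff_le {f : PowerSeries ℂ} (a : ℕ → ℝ) (ha : Summable a)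
    (h : ∀ n, ‖coeff n f‖ * r ^ n ≤ a n) : f ∈ SummableSeries r :=
  Summable.of_nonneg_of_le (fun n => term_nonneg f n) h ha

instance : NormOneClass (SummableSeries r) where
  norm_one := by
    rw [norm_def, tsum_eq_single 0 fun n hn => by simp [PowerSeries.coeff_one, hn]]
    simp

/-- Weighting the coefficients identifies `SummableSeries r` with `ℓ¹`. -/
noncomputable def toLp (f : SummableSeries r) : lp (fun _ : ℕ => ℂ) 1 :=
  ⟨fun n => coeff n (f : PowerSeries ℂ) * (r : ℂ) ^ n, by
    refine memℓp_gen ?_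
    simpa [abs_of_pos hr.out] using (summable f)⟩

lemma isometry_toLp : Isometry (toLp (r := r)) := by
  refine Isometry.of_dist_eq (fun f g => ?_)
  rw [dist_eq_norm, dist_eq_norm, lp.norm_eq_tsum_rpow (by simp), norm_def]
  simp only [ENNReal.toReal_one, Real.rpow_one, div_one]
  refine tsum_congr fun n => ?_
  change ‖coeff n (f : PowerSeries ℂ) * (r : ℂ) ^ n -
    coeff n (g : PowerSeries ℂ) * (r : ℂ) ^ n‖ = _
  simp [← sub_mul, abs_of_pos hr.out]

lemma surjective_toLp : Function.Surjective (toLp (r := r)) := by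
  intro a
  have hr0 : (r : ℂ) ≠ 0 := by exact_mod_cast hr.out.ne'
  have ha : Summable fun n => ‖a n‖ := by
    simpa using (memℓp_gen_iff (E := fun _ : ℕ => ℂ) (p := 1) (by simp)).mp (lp.memℓp a)
  refine ⟨⟨PowerSeries.mk fun n => a n / (r : ℂ) ^ n, ?_⟩, ?_⟩
  · refine mem_of_norm_coeff_le _ ha fun n => ?_
    simp [abs_of_pos hr.out, hr.out.ne']
  · ext n
    simp [toLp, hr0]

instance : CompleteSpace (SummableSeries r) :=
  ((isometry_toLp (r := r)).isUniformInducing.completeSpace_congr surjective_toLp).mpr inferInstance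

/-- The `n`-th coefficient, as a continuous linear functional. -/
noncomputable def coeffL (n : ℕ) : SummableSeries r →L[ℂ] ℂ :=
  LinearMap.mkContinuous ((coeff n).comp (SummableSeries r).val.toLinearMap) ((r ^ n)⁻¹) fun f => by
    rw [inv_mul_eq_div, le_div_iff₀ (pow_pos hr.out n)]
    exact norm_coeff_mul_le f n

@[simp] lemma coeffL_apply (n : ℕ) (f : SummableSeries r) :
    coeffL n f = coeff n (f : PowerSeries ℂ) := rfl

lemma norm_coeffL_le (n : ℕ) : ‖coeffL (r := r) n‖ ≤ (r ^ n)⁻¹ :=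
  LinearMap.mkContinuous_norm_le _ (inv_nonneg.mpr (pow_nonneg hr.out.le _)) _

/-- The coordinate function of the disc. -/
noncomputable def var : SummableSeries r :=
  ⟨PowerSeries.X, summable_of_ne_finset_zero (s := {1}) fun n hn => by
    have hn' : n ≠ 1 := by simpa using hn
    simp [PowerSeries.coeff_X, hn']⟩

@[simp] lemma coe_var : ((var : SummableSeries r) : PowerSeries ℂ) = PowerSeries.X := rfl

lemma norm_var : ‖(var : SummableSeries r)‖ = r := by
  rw [norm_def, tsum_eq_single 1 fun n hn => by simp [PowerSeries.coeff_X, hn]]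
  simp

lemma norm_le_of_norm_coeff_le {f g : SummableSeries r}
    (h : ∀ n, ‖coeff n (f : PowerSeries ℂ)‖ ≤ ‖coeff n (g : PowerSeries ℂ)‖) : ‖f‖ ≤ ‖g‖ :=
  (summable f).tsum_le_tsum
    (fun n => mul_le_mul_of_nonneg_right (h n) (pow_nonneg hr.out.le _)) (summable g)

lemma norm_div_succ_le (z : ℂ) (n : ℕ) : ‖z / ((n : ℂ) + 1)‖ ≤ ‖z‖ := by
  rw [norm_div]
  refine div_le_self (norm_nonneg _) ?_
  have : ‖(n : ℂ) + 1‖ = n + 1 := by exact_mod_cast Complex.norm_natCast (n + 1)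
  rw [this]; simp

/-- The series `∑ aₙ / (n + 1) xⁿ`, the mean value of `f` on the segment from `0` to `x`. -/
noncomputable def mean : SummableSeries r →L[ℂ] SummableSeries r :=
  LinearMap.mkContinuous
    { toFun := fun f => ⟨PowerSeries.mk fun n => coeff n (f : PowerSeries ℂ) / ((n : ℂ) + 1),
        mem_of_norm_coeff_le _ (summable f) fun n => mul_le_mul_of_nonneg_right
          (by simpa using norm_div_succ_le _ n) (pow_nonneg hr.out.le _)⟩
      map_add' := fun f g => by ext n; simp [add_div]
      map_smul' := fun c f => by ext n; simp [mul_div_assoc] } 1 fun f => by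
    rw [one_mul]
    exact norm_le_of_norm_coeff_le fun n => by simpa using norm_div_succ_le _ n

lemma coeff_mean (f : SummableSeries r) (n : ℕ) :
    coeff n (mean f : PowerSeries ℂ) = coeff n (f : PowerSeries ℂ) / ((n : ℂ) + 1) := by
  simp [mean]

/-- The primitive vanishing at the origin. -/
noncomputable def integ : SummableSeries r →L[ℂ] SummableSeries r :=
  (ContinuousLinearMap.mul ℂ (SummableSeries r) var).comp mean

lemma integ_apply (f : SummableSeries r) : integ f = var * mean f := rfl

lemma derivative_integ (f : SummableSeries r) :
    PowerSeries.derivative ℂ (integ f : PowerSeries ℂ) = f := by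
  ext n
  have : (n : ℂ) + 1 ≠ 0 := by exact_mod_cast n.succ_ne_zero
  rw [PowerSeries.coeff_derivative, integ_apply, Subalgebra.coe_mul, coe_var,
    PowerSeries.coeff_succ_X_mul, coeff_mean, div_mul_cancel₀ _ this]

lemma coeff_zero_integ (f : SummableSeries r) : coeff 0 (integ f : PowerSeries ℂ) = 0 := by
  simp [integ_apply]

/-- An element of `SummableSeries r` is determined by its constant term and its derivative. -/
lemma eq_add_integ {f g : SummableSeries r}
    (h : PowerSeries.derivative ℂ (f : PowerSeries ℂ) = g) :
    f = algebraMap ℂ _ (coeff 0 (f : PowerSeries ℂ)) + integ g := by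
  refine Subtype.ext (PowerSeries.derivative.ext ?_ ?_)
  · rw [h, Subalgebra.coe_add, map_add, derivative_integ]
    simp
  · have := coeff_zero_integ g
    simp only [PowerSeries.coeff_zero_eq_constantCoeff] at this ⊢
    simp [this]

section eval

lemma norm_term_le {x : ℂ} (hx : ‖x‖ ≤ r) (f : SummableSeries r) (n : ℕ) :
    ‖coeff n (f : PowerSeries ℂ) * x ^ n‖ ≤ ‖coeff n (f : PowerSeries ℂ)‖ * r ^ n := by
  rw [norm_mul, norm_pow]
  gcongr

lemma summable_eval {x : ℂ} (hx : ‖x‖ ≤ r) (f : SummableSeries r) :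
    Summable fun n => ‖coeff n (f : PowerSeries ℂ) * x ^ n‖ :=
  Summable.of_nonneg_of_le (fun _ => norm_nonneg _) (norm_term_le hx f) (summable f)

/-- The sum of the series at the point `x` (meaningful for `‖x‖ ≤ r`). -/
noncomputable def eval (x : ℂ) (f : SummableSeries r) : ℂ :=
  ∑' n, coeff n (f : PowerSeries ℂ) * x ^ n

lemma hasSum_eval {x : ℂ} (hx : ‖x‖ ≤ r) (f : SummableSeries r) :
    HasSum (fun n => coeff n (f : PowerSeries ℂ) * x ^ n) (eval x f) :=
  (summable_eval hx f).of_norm.hasSum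

/-- Evaluation at a point of the closed disc is a character. -/
noncomputable def evalHom (x : ℂ) (hx : ‖x‖ ≤ r) : SummableSeries r →ₐ[ℂ] ℂ :=
  AlgHom.ofLinearMap
    { toFun := eval x
      map_add' := fun f g => by
        refine ((hasSum_eval hx f).add (hasSum_eval hx g)).unique ?_ |>.symm
        simpa [add_mul] using hasSum_eval hx (f + g)
      map_smul' := fun c f => by
        refine ((hasSum_eval hx f).mul_left c).unique ?_ |>.symm
        simpa [mul_assoc] using hasSum_eval hx (c • f) }
    (by
      refine (hasSum_eval hx (1 : SummableSeries r)).unique ?_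
      convert hasSum_ite_eq (0 : ℕ) (1 : ℂ) using 2 with n
      by_cases hn : n = 0 <;> simp [PowerSeries.coeff_one, hn])
    (fun f g => by
      change eval x (f * g) = eval x f * eval x g
      rw [eval, eval, eval, tsum_mul_tsum_eq_tsum_sum_antidiagonal_of_summable_norm
        (summable_eval hx f) (summable_eval hx g)]
      refine tsum_congr fun n => ?_
      rw [Subalgebra.coe_mul, PowerSeries.coeff_mul, Finset.sum_mul]
      refine Finset.sum_congr rfl fun p hp => ?_
      rw [← Finset.HasAntidiagonal.mem_antidiagonal.mp hp, pow_add]; ring)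

lemma evalHom_apply {x : ℂ} (hx : ‖x‖ ≤ r) (f : SummableSeries r) : evalHom x hx f = eval x f := rfl

lemma norm_eval_le {x : ℂ} (hx : ‖x‖ ≤ r) (f : SummableSeries r) : ‖eval x f‖ ≤ ‖f‖ :=
  tsum_of_norm_bounded (summable f).hasSum (norm_term_le hx f)

lemma continuous_eval {x : ℂ} (hx : ‖x‖ ≤ r) : Continuous (eval (r := r) x) :=
  (LinearMap.mkContinuous (evalHom x hx).toLinearMap 1 fun f => by
    simpa [evalHom_apply] using norm_eval_le hx f).continuous

lemma eval_zero_left (f : SummableSeries r) : eval 0 f = coeff 0 (f : PowerSeries ℂ) := by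
  rw [eval, tsum_eq_single 0 fun n hn => by simp [hn]]
  simp

lemma eval_var (x : ℂ) : eval x (var : SummableSeries r) = x := by
  rw [eval, tsum_eq_single 1 fun n hn => by simp [PowerSeries.coeff_X, hn]]
  simp

lemma eventually_norm_le : ∀ᶠ x : ℂ in 𝓝 0, ‖x‖ ≤ r := by
  filter_upwards [Metric.ball_mem_nhds (0 : ℂ) hr.out] with x hx
  exact (mem_ball_zero_iff.mp hx).le

/-- Elements of `SummableSeries r` with the same germ of values at the origin are equal. -/
lemma ext_of_eval {f g : SummableSeries r} (h : ∀ᶠ x in 𝓝 (0 : ℂ), eval x f = eval x g) :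
    f = g := by
  have key : ∀ f : SummableSeries r, HasFPowerSeriesAt (fun x => eval x f)
      (FormalMultilinearSeries.ofScalars ℂ fun n => coeff n (f : PowerSeries ℂ)) 0 := by
    intro f
    rw [hasFPowerSeriesAt_iff]
    filter_upwards [eventually_norm_le (r := r)] with z hz
    simpa [FormalMultilinearSeries.coeff_ofScalars, mul_comm] using hasSum_eval hz f
  have := (key f).eq_formalMultilinearSeries_of_eventually (key g) h
  ext n
  have h2 := congrArg (fun p => p.coeff n) this
  simpa [FormalMultilinearSeries.coeff_ofScalars] using h2

lemma hasDerivAt_eval_integ (f : SummableSeries r) {x : ℂ} (hx : ‖x‖ < r) :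
    HasDerivAt (fun x => eval x (integ f)) (eval x f) x := by
  have key := hasDerivAt_tsum_of_isPreconnected (summable f) Metric.isOpen_ball
    (convex_ball (0 : ℂ) r).isPreconnected
    (g := fun n y => coeff n (f : PowerSeries ℂ) / ((n : ℂ) + 1) * y ^ (n + 1))
    (g' := fun n y => coeff n (f : PowerSeries ℂ) * y ^ n) (y₀ := 0) (y := x)
    (fun n y _ => ?_) (fun n y hy => norm_term_le (mem_ball_zero_iff.mp hy).le f n)
    (Metric.mem_ball_self hr.out) (by simp) (mem_ball_zero_iff.mpr hx)
  · refine key.congr_of_eventuallyEq ?_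
    filter_upwards [Metric.isOpen_ball.mem_nhds (mem_ball_zero_iff.mpr hx)] with y hy
    have hy' := (mem_ball_zero_iff.mp hy).le
    rw [integ_apply, ← evalHom_apply hy', map_mul, evalHom_apply, evalHom_apply, eval_var, eval,
      ← tsum_mul_left]
    refine tsum_congr fun n => ?_
    rw [coeff_mean]; ring
  · have : (n : ℂ) + 1 ≠ 0 := by exact_mod_cast n.succ_ne_zero
    refine ((hasDerivAt_pow (n + 1) y).const_mul _).congr_deriv ?_
    simp; field_simp

/-- The value `eval x f` depends analytically on the pair `(x, f)`. -/
lemma analyticAt_eval (f₀ : SummableSeries r) :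
    AnalyticAt ℂ (fun q : ℂ × SummableSeries r => eval q.1 q.2) (0, f₀) := by
  have hr2 : 0 < r / 2 := half_pos hr.out
  -- the evaluation functionals form a power series in `x` with values in the dual space
  have hbound : ∀ (n : ℕ) (x : ℂ), x ∈ Metric.ball (0 : ℂ) (r / 2) →
      ‖x ^ n • coeffL (r := r) n‖ ≤ (1 / 2 : ℝ) ^ n := by
    intro n x hx
    rw [norm_smul, norm_pow]
    calc ‖x‖ ^ n * ‖coeffL (r := r) n‖ ≤ (r / 2) ^ n * (r ^ n)⁻¹ := by
          gcongr
          · exact (mem_ball_zero_iff.mp hx).le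
          · exact norm_coeffL_le n
      _ = (1 / 2 : ℝ) ^ n := by
          have := hr.out.ne'
          rw [div_pow, div_pow, one_pow]; field_simp
  have hs : Summable fun n : ℕ => (1 / 2 : ℝ) ^ n := summable_geometric_two
  have hd := Complex.differentiableOn_tsum_of_summable_norm hs
    (F := fun n (x : ℂ) => x ^ n • coeffL (r := r) n)
    (fun n => by fun_prop) Metric.isOpen_ball hbound
  have ha : AnalyticAt ℂ (fun x : ℂ => ∑' n, x ^ n • coeffL (r := r) n) 0 :=
    hd.analyticAt (Metric.ball_mem_nhds _ hr2)
  have h2 : AnalyticAt ℂ (fun q : ℂ × SummableSeries r =>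
      (∑' n, q.1 ^ n • coeffL (r := r) n) q.2) (0, f₀) :=
    AnalyticAt.fun_comp
      (g := fun q : (SummableSeries r →L[ℂ] ℂ) × SummableSeries r =>
        ContinuousLinearMap.id ℂ (SummableSeries r →L[ℂ] ℂ) q.1 q.2)
      (ContinuousLinearMap.analyticAt_bilinear _ _)
      ((ha.comp_of_eq analyticAt_fst rfl).prod analyticAt_snd)
  refine h2.congr ?_
  have : ∀ᶠ q : ℂ × SummableSeries r in 𝓝 (0, f₀), q.1 ∈ Metric.ball (0 : ℂ) (r / 2) :=
    continuous_fst.continuousAt.eventually (Metric.ball_mem_nhds (0 : ℂ) hr2)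
  filter_upwards [this] with q hq
  have hsum : Summable fun n => q.1 ^ n • coeffL (r := r) n :=
    Summable.of_norm_bounded hs fun n => hbound n q.1 hq
  have := hsum.hasSum.mapL (ContinuousLinearMap.apply ℂ ℂ q.2)
  have h3 := this.tsum_eq
  simp only [ContinuousLinearMap.apply_apply] at h3
  rw [← h3, eval]
  exact tsum_congr fun n => by simp [mul_comm]

end eval

/-! ### Analytic germs with parameters as analytic maps to the Banach algebra -/

section baseChange

variable {V ι : Type*} [NormedAddCommGroup V] [NormedSpace ℂ V] [Fintype ι]

/-- Base change of a power series from `ℂ` to `SummableSeries r`: in the coordinates given by a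
finite family of vectors `e`, the scalar coordinates are replaced by elements of the algebra. -/
noncomputable def baseChange (r : ℝ) [hr : Fact (0 < r)] (p : FormalMultilinearSeries ℂ V ℂ)
    (e : ι → V) : FormalMultilinearSeries ℂ (ι → SummableSeries r) (SummableSeries r) :=
  fun n => ∑ i : Fin n → ι, p n (fun j => e (i j)) •
    (ContinuousMultilinearMap.mkPiAlgebra ℂ (Fin n) (SummableSeries r)).compContinuousLinearMap
      (fun j => ContinuousLinearMap.proj (i j))

lemma baseChange_apply (p : FormalMultilinearSeries ℂ V ℂ) (e : ι → V) (n : ℕ)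
    (a : Fin n → ι → SummableSeries r) :
    baseChange r p e n a = ∑ i : Fin n → ι, p n (fun j => e (i j)) • ∏ j, a j (i j) := by
  simp [baseChange]

lemma norm_baseChange_le (p : FormalMultilinearSeries ℂ V ℂ) (e : ι → V) (he : ∀ i, ‖e i‖ ≤ 1)
    (n : ℕ) : ‖baseChange r p e n‖ ≤ (Fintype.card ι : ℝ) ^ n * ‖p n‖ := by
  refine (norm_sum_le _ _).trans ?_
  have h : ∀ i : Fin n → ι, ‖p n (fun j => e (i j)) •
      (ContinuousMultilinearMap.mkPiAlgebra ℂ (Fin n) (SummableSeries r)).compContinuousLinearMap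
      (fun j => ContinuousLinearMap.proj (R := ℂ) (φ := fun _ : ι => SummableSeries r) (i j))‖
        ≤ ‖p n‖ := by
    intro i
    rw [norm_smul]
    have h1 : ‖p n (fun j => e (i j))‖ ≤ ‖p n‖ * 1 := by
      refine ((p n).le_opNorm _).trans ?_
      gcongr
      exact Finset.prod_le_one (fun _ _ => norm_nonneg _) fun _ _ => he _
    have h2 : ‖(ContinuousMultilinearMap.mkPiAlgebra ℂ (Fin n)
        (SummableSeries r)).compContinuousLinearMap (fun j =>
        ContinuousLinearMap.proj (R := ℂ) (φ := fun _ : ι => SummableSeries r) (i j))‖ ≤ 1 := by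
      refine (ContinuousMultilinearMap.norm_compContinuousLinearMap_le _ _).trans ?_
      rw [ContinuousMultilinearMap.norm_mkPiAlgebra, one_mul]
      exact Finset.prod_le_one (fun _ _ => norm_nonneg _) fun j _ =>
        ContinuousLinearMap.opNorm_le_bound _ zero_le_one fun f => by
          simpa using norm_le_pi_norm f (i j)
    calc _ ≤ ‖p n‖ * 1 * 1 := by gcongr
      _ = ‖p n‖ := by ring
  refine (Finset.sum_le_card_nsmul _ _ _ fun i _ => h i).trans ?_
  simp

lemma eval_baseChange {x : ℂ} (hx : ‖x‖ ≤ r) (p : FormalMultilinearSeries ℂ V ℂ) (e : ι → V)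
    (n : ℕ) (a : ι → SummableSeries r) :
    eval x (baseChange r p e n fun _ => a) = p n fun _ => ∑ i, eval x (a i) • e i := by
  classical
  rw [(p n).map_sum, baseChange_apply, ← evalHom_apply hx]
  simp_rw [map_sum, map_smul, map_prod, (p n).map_smul_univ, evalHom_apply, smul_eq_mul]
  exact Finset.sum_congr rfl fun i _ => mul_comm _ _

/-- A lower bound for the radius of convergence after base change, uniform in `r`. -/
lemma exists_le_radius_baseChange (p : FormalMultilinearSeries ℂ V ℂ) (hp : 0 < p.radius)
    (e : ι → V) (he : ∀ i, ‖e i‖ ≤ 1) :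
    ∃ ρ : NNReal, 0 < ρ ∧ ∀ (r : ℝ) [Fact (0 < r)], (ρ : ENNReal) ≤ (baseChange r p e).radius := by
  obtain ⟨C, a, hC, ha, h⟩ := p.le_mul_pow_of_radius_pos hp
  have hN : (0 : ℝ) < Fintype.card ι + 1 := by positivity
  refine ⟨⟨((Fintype.card ι + 1) * a)⁻¹, by positivity⟩, ?_, fun r _ => ?_⟩
  · exact inv_pos.mpr (mul_pos hN ha)
  · refine (baseChange r p e).le_radius_of_bound C fun n => ?_
    change _ * (((Fintype.card ι + 1) * a)⁻¹) ^ n ≤ C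
    calc ‖baseChange r p e n‖ * (((Fintype.card ι + 1) * a)⁻¹) ^ n
        ≤ ((Fintype.card ι + 1 : ℝ) ^ n * (C * a ^ n)) * (((Fintype.card ι + 1) * a)⁻¹) ^ n := by
          gcongr
          refine (norm_baseChange_le p e he n).trans ?_
          gcongr
          · linarith
          · exact h n
      _ = C := by
          rw [inv_pow, mul_pow]
          field_simp

end baseChange

/-- A germ of an analytic function of `(x, l)` is a germ of an analytic map from the parameter
space to the Banach algebra `SummableSeries r`, for all small radii `r`. -/
theorem exists_analyticAt_eval_eq {m : ℕ} {X : ℂ × (Fin m → ℂ) → ℂ} (hX : AnalyticAt ℂ X 0) :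
    ∃ r₀ : ℝ, 0 < r₀ ∧ ∀ (r : ℝ) [Fact (0 < r)], r < r₀ →
      ∃ F : (Fin m → ℂ) → SummableSeries r, AnalyticAt ℂ F 0 ∧
        ∀ᶠ l in 𝓝 0, ∀ x : ℂ, ‖x‖ ≤ r → eval x (F l) = X (x, l) := by
  obtain ⟨p, R, hp⟩ := hX
  let e : Option (Fin m) → ℂ × (Fin m → ℂ) := fun i => i.elim (1, 0) fun j => (0, Pi.single j 1)
  have he : ∀ i, ‖e i‖ ≤ 1 := by
    rintro (_ | j)
    · simp [e]
    · refine (Prod.norm_def _).trans_le (max_le (by simp [e]) ?_)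
      rw [pi_norm_le_iff_of_nonneg zero_le_one]
      intro i
      by_cases h : i = j
      · subst h; simp [e]
      · simp [e, h]
  obtain ⟨ρ, hρ, hrad⟩ := exists_le_radius_baseChange p (hp.r_pos.trans_le hp.r_le) e he
  obtain ⟨R', hR', hR'R⟩ := ENNReal.lt_iff_exists_nnreal_btwn.mp hp.r_pos
  have hR'0 : 0 < R' := by exact_mod_cast hR'
  refine ⟨min ρ R', lt_min hρ hR'0, fun r hr hlt => ?_⟩
  let a : (Fin m → ℂ) → Option (Fin m) → SummableSeries r := fun l i =>
    i.elim var fun j => algebraMap ℂ _ (l j)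
  have ha : Continuous a := by
    refine continuous_pi fun i => ?_
    cases i with
    | none => exact continuous_const
    | some j => exact (algebraMapCLM ℂ (SummableSeries r)).continuous.comp (continuous_apply j)
  have haA : AnalyticAt ℂ a 0 := by
    refine analyticAt_pi_iff.mpr fun i => ?_
    cases i with
    | none => exact analyticAt_const
    | some j => exact ((algebraMapCLM ℂ (SummableSeries r)).comp
        (ContinuousLinearMap.proj (R := ℂ) (φ := fun _ : Fin m => ℂ) j)).analyticAt _
  have hq := (baseChange r p e).hasFPowerSeriesOnBall
    (lt_of_lt_of_le (by exact_mod_cast hρ) (hrad r))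
  have hmem : ∀ᶠ l in 𝓝 (0 : Fin m → ℂ), 
      a l ∈ Metric.ball (0 : Option (Fin m) → SummableSeries r) ρ := by
    refine ha.continuousAt.eventually (Metric.isOpen_ball.mem_nhds ?_)
    rw [mem_ball_zero_iff, pi_norm_lt_iff (NNReal.coe_pos.mpr hρ)]
    rintro (_ | j)
    · exact (norm_var (r := r)).trans_lt (hlt.trans_le (min_le_left _ _))
    · simpa [a] using hρ
  have hmem' : ∀ b ∈ Metric.ball (0 : Option (Fin m) → SummableSeries r) ρ,
      b ∈ Metric.eball (0 : Option (Fin m) → SummableSeries r) (baseChange r p e).radius := by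
    intro b hb
    refine Metric.eball_subset_eball (hrad r) ?_
    rwa [Metric.eball_coe]
  refine ⟨fun l => (baseChange r p e).sum (a l), ?_, ?_⟩
  · exact (hq.analyticAt_of_mem (hmem' _ hmem.self_of_nhds)).fun_comp haA
  · have hl : ∀ᶠ l in 𝓝 (0 : Fin m → ℂ), l ∈ Metric.ball (0 : Fin m → ℂ) R' :=
      Metric.ball_mem_nhds _ hR'0
    filter_upwards [hmem, hl] with l h1 h2 x hx
    have hs := (hq.hasSum (y := a l) (hmem' _ h1)).map (evalHom x hx) (continuous_eval hx)
    rw [zero_add] at hs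
    have hv : (∑ i, eval x (a l i) • e i) = (x, l) := by
      have hvar : eval x (a l none) = x := eval_var x
      have hc : ∀ j, eval x (a l (some j)) = l j := fun j => by
        rw [← evalHom_apply hx]; exact AlgHom.commutes _ _
      rw [Fintype.sum_option, hvar]
      simp_rw [hc]
      refine Prod.ext ?_ ?_
      · simp [e, Prod.fst_sum]
      · ext j
        simp [e, Prod.snd_sum, Finset.sum_apply, Pi.single_apply]
    have hx' : ((x, l) : ℂ × (Fin m → ℂ)) ∈ Metric.eball (0 : ℂ × (Fin m → ℂ)) R := by
      refine Metric.eball_subset_eball hR'R.le ?_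
      rw [Metric.eball_coe, mem_ball_zero_iff, Prod.norm_def]
      exact max_lt ((hx.trans_lt hlt).trans_le (min_le_right _ _)) (mem_ball_zero_iff.mp h2)
    have hs' := hp.hasSum hx'
    rw [zero_add] at hs'
    refine hs.unique (Eq.mpr (congrArg (HasSum · _) (funext fun n => ?_)) hs')
    rw [Function.comp_apply, evalHom_apply, eval_baseChange hx, hv]

end SummableSeries

/-! ### The conjugacy equation and its derivative -/

open SummableSeries

open PowerSeries (coeff)

section Banach

variable {r : ℝ} [hr : Fact (0 < r)] {k : ℕ} {μ : ℂ}

/-- The unknowns of the conjugacy problem: `(c, g, y)` stands for the change of coordinate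
`φ = x + c + ∫₀ˣ g` and the parameter `y` of the normal form. Using `g = φ' - 1` as an unknown
avoids differentiating in `SummableSeries r`. -/
abbrev Unknowns (r : ℝ) [Fact (0 < r)] (k : ℕ) : Type :=
  ℂ × SummableSeries r × ((Fin k → ℂ) × ℂ)

/-- The displacement `φ - x`. -/
noncomputable def displacement (r : ℝ) [Fact (0 < r)] (k : ℕ) :
    Unknowns r k →L[ℂ] SummableSeries r :=
  (algebraMapCLM ℂ (SummableSeries r)).comp (ContinuousLinearMap.fst ℂ _ _) +
    integ.comp ((ContinuousLinearMap.fst ℂ _ _).comp (ContinuousLinearMap.snd ℂ _ _))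

lemma displacement_apply (u : Unknowns r k) :
    displacement r k u = algebraMap ℂ _ u.1 + integ u.2.1 := rfl

lemma derivative_displacement (u : Unknowns r k) :
    PowerSeries.derivative ℂ (displacement r k u : PowerSeries ℂ) = u.2.1 := by
  rw [displacement_apply, Subalgebra.coe_add, map_add, derivative_integ, Subalgebra.coe_algebraMap,
    Derivation.map_algebraMap, zero_add]

lemma coeff_zero_displacement (u : Unknowns r k) :
    coeff 0 (displacement r k u : PowerSeries ℂ) = u.1 := by
  rw [displacement_apply, Subalgebra.coe_add, map_add, coeff_zero_integ]
  simp

lemma displacement_eq {f g : SummableSeries r}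
    (h : PowerSeries.derivative ℂ (f : PowerSeries ℂ) = g) (y : (Fin k → ℂ) × ℂ) :
    displacement r k (coeff 0 (f : PowerSeries ℂ), g, y) = f :=
  (eq_add_integ h).symm

/-- The change of coordinate `φ`. -/
noncomputable def coord (u : Unknowns r k) : SummableSeries r := var + displacement r k u

/-- The denominator `1 + (μ + y_{2k+1}) φ^k` of the normal form along `φ`. -/
noncomputable def denom (μ : ℂ) (u : Unknowns r k) : SummableSeries r :=
  1 + (μ + u.2.2.2) • coord u ^ k

/-- The numerator `φ^{k+1} + ∑ yⱼ φ^j` of the normal form along `φ`. -/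
noncomputable def numer (u : Unknowns r k) : SummableSeries r :=
  coord u ^ (k + 1) + ∑ j : Fin k, u.2.2.1 j • coord u ^ (j : ℕ)

/-- The derivative of the denominator with respect to `φ`. -/
noncomputable def denomDeriv (μ : ℂ) (u : Unknowns r k) : SummableSeries r :=
  (μ + u.2.2.2) • ((k : SummableSeries r) * coord u ^ (k - 1))

/-- The derivative of the numerator with respect to `φ`. -/
noncomputable def numerDeriv (u : Unknowns r k) : SummableSeries r :=
  ((k : SummableSeries r) + 1) * coord u ^ k +
    ∑ j : Fin k, u.2.2.1 j • (((j : ℕ) : SummableSeries r) * coord u ^ ((j : ℕ) - 1))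

/-- The conjugacy equation `φ' X = numer / denom`, cleared of its denominator; the unknowns and
the vector field `X` are both arguments. -/
noncomputable def conjEq (μ : ℂ) (q : Unknowns r k × SummableSeries r) : SummableSeries r :=
  denom μ q.1 * (1 + q.1.2.1) * q.2 - numer q.1

/-- The derivative of `conjEq` at `q` in the direction `v`. -/
noncomputable def conjEqDeriv (μ : ℂ) (q v : Unknowns r k × SummableSeries r) : SummableSeries r :=
  (v.1.2.2.2 • coord q.1 ^ k + denomDeriv μ q.1 * displacement r k v.1) * (1 + q.1.2.1) * q.2 +
    denom μ q.1 * v.1.2.1 * q.2 + denom μ q.1 * (1 + q.1.2.1) * v.2 -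
    (numerDeriv q.1 * displacement r k v.1 + ∑ j : Fin k, v.1.2.2.1 j • coord q.1 ^ (j : ℕ))

lemma contDiff_conjEq : ContDiff ℂ ⊤ (conjEq (r := r) (k := k) μ) := by
  unfold conjEq denom numer coord
  fun_prop

lemma fderiv_conjEq (q v : Unknowns r k × SummableSeries r) :
    fderiv ℂ (conjEq μ) q v = conjEqDeriv μ q v := by
  have h1 := (contDiff_conjEq (r := r) (k := k) (μ := μ)).differentiable (by simp) q
  have hline : HasDerivAt (fun s : ℂ => q + s • v) v 0 := by
    simpa using ((hasDerivAt_id (0 : ℂ)).smul_const v).const_add q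
  have h2 : HasDerivAt (fun s : ℂ => conjEq μ (q + s • v)) (fderiv ℂ (conjEq μ) q v) 0 :=
    HasFDerivAt.comp_hasDerivAt_of_eq (0 : ℂ) h1.hasFDerivAt hline (by simp)
  refine h2.unique ?_
  have hcoord : HasDerivAt (fun s : ℂ => coord (q + s • v).1) (displacement r k v.1) 0 := by
    have := (((hasDerivAt_id (0 : ℂ)).smul_const (displacement r k v.1)).const_add (coord q.1))
    refine (this.congr_deriv (by simp)).congr_of_eventuallyEq (.of_forall fun s => ?_)
    simp [coord, add_assoc]
  have hg : HasDerivAt (fun s : ℂ => 1 + (q + s • v).1.2.1) v.1.2.1 0 := by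
    simpa using (((hasDerivAt_id (0 : ℂ)).smul_const v.1.2.1).const_add q.1.2.1).const_add 1
  have hX : HasDerivAt (fun s : ℂ => (q + s • v).2) v.2 0 := by
    simpa using ((hasDerivAt_id (0 : ℂ)).smul_const v.2).const_add q.2
  have hy : HasDerivAt (fun s : ℂ => μ + (q + s • v).1.2.2.2) v.1.2.2.2 0 := by
    simpa using (((hasDerivAt_id (0 : ℂ)).smul_const v.1.2.2.2).const_add q.1.2.2.2).const_add μ
  have hyj : ∀ j, HasDerivAt (fun s : ℂ => (q + s • v).1.2.2.1 j) (v.1.2.2.1 j) 0 := fun j => by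
    simpa using ((hasDerivAt_id (0 : ℂ)).smul_const (v.1.2.2.1 j)).const_add (q.1.2.2.1 j)
  have hden : HasDerivAt (fun s : ℂ => denom μ (q + s • v).1) _ 0 :=
    (hy.smul (hcoord.pow k)).const_add 1
  have hnum : HasDerivAt (fun s : ℂ => numer (q + s • v).1) _ 0 :=
    (hcoord.pow (k + 1)).add (HasDerivAt.fun_sum fun j _ => (hyj j).smul (hcoord.pow (j : ℕ)))
  refine (((hden.mul hg).mul hX).sub hnum).congr_deriv ?_
  simp only [conjEqDeriv, denomDeriv, numerDeriv, zero_smul, add_zero, Pi.pow_apply,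
    Finset.sum_add_distrib, add_mul, Finset.sum_mul, smul_mul_assoc]
  simp [denom]
  ring

end Banach

/-! ### Inverting the linearized conjugacy equation at the identity -/

namespace SummableSeries

variable {r : ℝ} [hr : Fact (0 < r)]

/-- Division by a power of the variable. -/
lemma exists_eq_var_pow_mul (k : ℕ) (f : SummableSeries r)
    (h : ∀ n < k, coeff n (f : PowerSeries ℂ) = 0) : ∃ e : SummableSeries r, f = var ^ k * e := by
  have hrk : r ^ k ≠ 0 := pow_ne_zero _ hr.out.ne'
  refine ⟨⟨PowerSeries.mk fun n => coeff (n + k) (f : PowerSeries ℂ),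
    mem_of_norm_coeff_le _ (((summable_nat_add_iff k).mpr (summable f)).div_const (r ^ k))
      fun n => ?_⟩, ?_⟩
  · rw [PowerSeries.coeff_mk, pow_add]
    exact le_of_eq (by field_simp)
  · ext n
    rw [Subalgebra.coe_mul, Subalgebra.coe_pow, coe_var, PowerSeries.coeff_X_pow_mul']
    split_ifs with hn
    · simp [Nat.sub_add_cancel hn]
    · exact h n (not_le.mp hn)

/-- The operator `x d/dx - N` is invertible in the complement of `x ^ N`: it is diagonal on
monomials, with eigenvalues `n - N` bounded away from `0`. -/
lemma exists_euler_eq (N : ℕ) (e : SummableSeries r) (t : ℂ) :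
    ∃ ζ ζ' : SummableSeries r, PowerSeries.derivative ℂ (ζ : PowerSeries ℂ) = ζ' ∧
      coeff N (ζ : PowerSeries ℂ) = t ∧
      var * ζ' - (N : SummableSeries r) * ζ + coeff N (e : PowerSeries ℂ) • var ^ N = e := by
  have hbound : ∀ n, n ≠ N → ∀ z : ℂ, ‖z / ((n : ℂ) - N)‖ ≤ ‖z‖ := by
    intro n hn z
    rw [norm_div]
    refine div_le_self (norm_nonneg _) ?_
    have h1 : (n : ℂ) - N = ((n - N : ℤ) : ℂ) := by push_cast; rfl
    rw [h1, Complex.norm_intCast]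
    have h2 : (n - N : ℤ) ≠ 0 := sub_ne_zero.mpr (by exact_mod_cast hn)
    exact_mod_cast Int.one_le_abs h2
  let z : PowerSeries ℂ := PowerSeries.mk fun n =>
    if n = N then t else coeff n (e : PowerSeries ℂ) / ((n : ℂ) - N)
  have hz : z ∈ SummableSeries r := by
    refine mem_of_norm_coeff_le _ ((summable e).add
      (summable_of_ne_finset_zero (f := fun n => if n = N then ‖t‖ * r ^ N else 0) (s := {N})
        fun n hn => by simpa using fun h => absurd h (by simpa using hn))) fun n => ?_
    by_cases hn : n = N
    · subst hn
      simpa [z] using term_nonneg _ _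
    · simp only [z, PowerSeries.coeff_mk, hn, if_false, add_zero]
      exact mul_le_mul_of_nonneg_right (hbound n hn _) (pow_nonneg hr.out.le _)
  let ζ : SummableSeries r := ⟨z, hz⟩
  have hcoeff : ∀ n, coeff n (ζ : PowerSeries ℂ) =
      if n = N then t else coeff n (e : PowerSeries ℂ) / ((n : ℂ) - N) := fun n => by simp [ζ, z]
  have hval : ∀ n, coeff n ((e + (N : SummableSeries r) * ζ -
      coeff N (e : PowerSeries ℂ) • var ^ N : SummableSeries r) : PowerSeries ℂ) =
      n * coeff n (ζ : PowerSeries ℂ) := by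
    intro n
    have hN : ((N : SummableSeries r) * ζ : SummableSeries r) = (N : ℂ) • ζ := by
      rw [Algebra.smul_def, map_natCast]
    rw [hN]
    simp only [Subalgebra.coe_sub, Subalgebra.coe_add, Subalgebra.coe_smul, Subalgebra.coe_pow,
      coe_var, map_sub, map_add, PowerSeries.coeff_smul, smul_eq_mul, PowerSeries.coeff_X_pow,
      hcoeff]
    by_cases hn : n = N
    · subst hn; simp
    · have : (n : ℂ) - N ≠ 0 := sub_ne_zero.mpr (by exact_mod_cast hn)
      simp only [hn, if_false]
      field_simp
      ring
  obtain ⟨ζ', hζ'⟩ := exists_eq_var_pow_mul 1 _ fun n hn => by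
    rw [hval, Nat.lt_one_iff.mp hn]; simp
  rw [pow_one] at hζ'
  refine ⟨ζ, ζ', ?_, by simp [hcoeff], by rw [← hζ']; ring⟩
  ext n
  have := hval (n + 1)
  rw [hζ', Subalgebra.coe_mul, coe_var, PowerSeries.coeff_succ_X_mul] at this
  rw [this, PowerSeries.coeff_derivative]
  push_cast; ring

/-- Differentiation does not preserve `SummableSeries r`, but the elements with derivative in
`SummableSeries r` are stable under division by units. -/
lemma exists_derivative_eq {w f η w' f' : SummableSeries r} (hw : IsUnit w)
    (h : w * η = f) (hdw : PowerSeries.derivative ℂ (w : PowerSeries ℂ) = w')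
    (hdf : PowerSeries.derivative ℂ (f : PowerSeries ℂ) = f') :
    ∃ η' : SummableSeries r, PowerSeries.derivative ℂ (η : PowerSeries ℂ) = η' ∧
      w * η' = f' - w' * η := by
  obtain ⟨b, hb⟩ := hw.exists_left_inv
  have hb' : (b : PowerSeries ℂ) * w = 1 := by
    rw [← Subalgebra.coe_mul, hb, Subalgebra.coe_one]
  have hη : (f' : PowerSeries ℂ) = w * PowerSeries.derivative ℂ (η : PowerSeries ℂ) + η * w' := by
    rw [← hdf, ← h, Subalgebra.coe_mul, Derivation.leibniz, hdw]
    rfl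
  refine ⟨b * (f' - w' * η), ?_, by rw [← mul_assoc, mul_comm w b, hb, one_mul]⟩
  rw [Subalgebra.coe_mul, Subalgebra.coe_sub, Subalgebra.coe_mul, hη]
  linear_combination (-PowerSeries.derivative ℂ (η : PowerSeries ℂ)) * hb'

end SummableSeries

section Banach

variable {r : ℝ} [hr : Fact (0 < r)] {k : ℕ} {μ : ℂ}

lemma derivative_one_add_smul_var_pow (k : ℕ) (μ : ℂ) :
    PowerSeries.derivative ℂ ((1 + μ • var ^ k : SummableSeries r) : PowerSeries ℂ) =
      ((μ • ((k : SummableSeries r) * var ^ (k - 1)) : SummableSeries r) : PowerSeries ℂ) := by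
  simp

/-- The linearized conjugacy equation at the identity, multiplied by `w = 1 + μ x^k`, becomes
the Euler operator in the unknown `ζ = w ξ`, up to terms in the parameters. -/
lemma denom_mul_conjEqDeriv (hk : 1 ≤ k) {w X₀ ζ' : SummableSeries r} {v : Unknowns r k}
    (hw : w = 1 + μ • var ^ k) (hX : w * X₀ = var ^ (k + 1))
    (hζ' : PowerSeries.derivative ℂ (w * displacement r k v : SummableSeries r) = ζ') :
    w * conjEqDeriv μ ((0 : Unknowns r k), X₀) (v, 0) =
      var ^ k * (var * ζ' - ((k + 1 : ℕ) : SummableSeries r) * (w * displacement r k v) +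
        v.2.2.2 • var ^ (k + 1)) - w * ∑ j : Fin k, v.2.2.1 j • var ^ (j : ℕ) := by
  have hζ : ζ' = w * v.2.1 + μ • ((k : SummableSeries r) * var ^ (k - 1)) * displacement r k v := by
    apply Subtype.ext
    rw [← hζ', Subalgebra.coe_mul, Derivation.leibniz, derivative_displacement, hw,
      derivative_one_add_smul_var_pow]
    simp only [Subalgebra.coe_add, Subalgebra.coe_mul, smul_eq_mul]
    ring
  obtain ⟨n, rfl⟩ : ∃ n, k = n + 1 := ⟨k - 1, by omega⟩
  simp only [conjEqDeriv, coord, denom, denomDeriv, numerDeriv, map_zero, add_zero,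
    Prod.fst_zero, Prod.snd_zero, mul_zero, zero_mul, Pi.zero_apply,
    Finset.sum_const_zero, mul_one, hζ, Nat.add_sub_cancel, Algebra.smul_def]
  have hw' : w = 1 + algebraMap ℂ (SummableSeries r) μ * var ^ (n + 1) := by
    rw [hw, Algebra.smul_def]
  push_cast
  linear_combination (- w * X₀ * v.2.1) * hw' +
    ((algebraMap ℂ (SummableSeries r) v.2.2.2) * var ^ (n + 1) +
    algebraMap ℂ (SummableSeries r) μ * ((n + 1) * var ^ n) * displacement r (n + 1) v +
    w * v.2.1) * hX

/-- The linear functional normalizing the change of coordinate: the coefficient of `x ^ (k + 1)` in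
`(1 + μ x ^ k) ξ`, where `ξ` is the displacement. It is nonzero on the infinitesimal symmetry of
the parabolic normal form. -/
noncomputable def normalization (μ : ℂ) : Unknowns r k →L[ℂ] ℂ :=
  (coeffL (k + 1)).comp
    ((ContinuousLinearMap.mul ℂ (SummableSeries r) (1 + μ • var ^ k)).comp (displacement r k))

lemma normalization_apply (v : Unknowns r k) : normalization μ v =
    coeff (k + 1) (((1 + μ • var ^ k) * displacement r k v : SummableSeries r) : PowerSeries ℂ) :=
  rfl

lemma coeff_sum_smul_var_pow (y : Fin k → ℂ) (n : ℕ) :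
    coeff n ((∑ j : Fin k, y j • var ^ (j : ℕ) : SummableSeries r) : PowerSeries ℂ) =
      if h : n < k then y ⟨n, h⟩ else 0 := by
  have : ((∑ j : Fin k, y j • var ^ (j : ℕ) : SummableSeries r) : PowerSeries ℂ) =
      ∑ j : Fin k, y j • PowerSeries.X ^ (j : ℕ) := by
    simp
  rw [this, map_sum]
  simp only [PowerSeries.coeff_smul, PowerSeries.coeff_X_pow, smul_eq_mul, mul_ite, mul_one,
    mul_zero]
  split_ifs with h
  · rw [Finset.sum_eq_single ⟨n, h⟩]
    · simp
    · intro j _ hj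
      rw [if_neg]
      rintro rfl
      exact hj rfl
    · simp
  · refine Finset.sum_eq_zero fun j _ => if_neg ?_
    rintro rfl
    exact h j.2

lemma exists_derivative_mul_displacement (v : Unknowns r k) (μ : ℂ) : ∃ ζ' : SummableSeries r,
    PowerSeries.derivative ℂ
      (((1 + μ • var ^ k) * displacement r k v : SummableSeries r) : PowerSeries ℂ) = ζ' := by
  refine ⟨(1 + μ • var ^ k) * v.2.1 +
    displacement r k v * (μ • ((k : SummableSeries r) * var ^ (k - 1))), ?_⟩
  rw [Subalgebra.coe_mul, Derivation.leibniz, derivative_displacement,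
    derivative_one_add_smul_var_pow]
  rfl

lemma eq_zero_of_conjEqDeriv_eq_zero (hk : 1 ≤ k) {X₀ : SummableSeries r}
    (hw : IsUnit (1 + μ • var ^ k : SummableSeries r))
    (hX : (1 + μ • var ^ k) * X₀ = var ^ (k + 1)) {v : Unknowns r k}
    (h : conjEqDeriv μ ((0 : Unknowns r k), X₀) (v, 0) = 0) (ht : normalization μ v = 0) :
    v = 0 := by
  obtain ⟨ζ', hζ'⟩ := exists_derivative_mul_displacement v μ
  have key := denom_mul_conjEqDeriv hk rfl hX hζ'
  rw [h, mul_zero] at key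
  set P : SummableSeries r := ∑ j : Fin k, v.2.2.1 j • var ^ (j : ℕ) with hP
  set ζ : SummableSeries r := (1 + μ • var ^ k) * displacement r k v with hζ
  -- the coefficients of degree less than `k` give the parameters `yⱼ`
  have hP' : P = var ^ k * (var * ζ' - ((k + 1 : ℕ) : SummableSeries r) * ζ +
      v.2.2.2 • var ^ (k + 1) - μ • P) := by
    rw [Algebra.smul_def μ] at key ⊢
    linear_combination key
  have hy : v.2.2.1 = 0 := by
    ext ⟨n, hn⟩
    have h1 := coeff_sum_smul_var_pow (r := r) v.2.2.1 n
    rw [← hP, hP', Subalgebra.coe_mul, Subalgebra.coe_pow, coe_var, PowerSeries.coeff_X_pow_mul',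
      if_neg (not_le.mpr hn), dif_pos hn] at h1
    exact h1.symm
  have hP0 : P = 0 := by simp [hP, hy]
  have hE : (PowerSeries.X * (ζ' : PowerSeries ℂ) -
      ((k + 1 : ℕ) : PowerSeries ℂ) * (ζ : PowerSeries ℂ) + v.2.2.2 • PowerSeries.X ^ (k + 1)) = 0 := by
    have h1 := congrArg (fun f : SummableSeries r => (f : PowerSeries ℂ)) hP'
    rw [hP0] at h1
    refine PowerSeries.X_pow_mul_cancel (k := k) ?_
    rw [mul_zero]
    simpa using h1.symm
  have hcoeff : ∀ n : ℕ, ((n : ℂ) - (k + 1 : ℕ)) * coeff n (ζ : PowerSeries ℂ) +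
      v.2.2.2 * (if n = k + 1 then 1 else 0) = 0 := by
    intro n
    have h1 := congrArg (coeff n) hE
    have h2 : ((k + 1 : ℕ) : PowerSeries ℂ) * (ζ : PowerSeries ℂ) =
        ((k + 1 : ℕ) : ℂ) • (ζ : PowerSeries ℂ) := by
      rw [Algebra.smul_def, map_natCast]
    have h3 : coeff n (PowerSeries.X * (ζ' : PowerSeries ℂ)) = n * coeff n (ζ : PowerSeries ℂ) := by
      cases n with
      | zero => simp
      | succ n =>
        rw [PowerSeries.coeff_succ_X_mul, ← hζ', PowerSeries.coeff_derivative]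
        push_cast; ring
    rw [h2, map_add, map_sub, h3, PowerSeries.coeff_smul, PowerSeries.coeff_smul,
      PowerSeries.coeff_X_pow, map_zero, smul_eq_mul, smul_eq_mul] at h1
    linear_combination h1
  have hy' : v.2.2.2 = 0 := by simpa using hcoeff (k + 1)
  have hζ0 : ζ = 0 := by
    ext n
    by_cases hn : n = k + 1
    · subst hn
      exact ht
    · have h1 := hcoeff n
      have h2 : (n : ℂ) - (k + 1 : ℕ) ≠ 0 := sub_ne_zero.mpr (by exact_mod_cast hn)
      rw [if_neg hn, mul_zero, add_zero] at h1
      simpa using (mul_eq_zero.mp h1).resolve_left h2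
  have hdisp : displacement r k v = 0 := by
    rw [hζ] at hζ0
    exact (hw.mul_right_eq_zero).mp hζ0
  have hc : v.1 = 0 := by
    rw [← coeff_zero_displacement v, hdisp]; simp
  have hg : v.2.1 = 0 := by
    apply Subtype.ext
    rw [← derivative_displacement v, hdisp]; simp
  exact Prod.ext hc (Prod.ext hg (Prod.ext hy hy'))

lemma exists_conjEqDeriv_eq (hk : 1 ≤ k) {X₀ : SummableSeries r}
    (hw : IsUnit (1 + μ • var ^ k : SummableSeries r))
    (hX : (1 + μ • var ^ k) * X₀ = var ^ (k + 1)) (h : SummableSeries r) (t : ℂ) :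
    ∃ v : Unknowns r k, conjEqDeriv μ ((0 : Unknowns r k), X₀) (v, 0) = h ∧
      normalization μ v = t := by
  set w : SummableSeries r := 1 + μ • var ^ k with hwdef
  let y : Fin k → ℂ := fun j => - coeff (j : ℕ) ((w * h : SummableSeries r) : PowerSeries ℂ)
  set P : SummableSeries r := ∑ j : Fin k, y j • var ^ (j : ℕ) with hP
  obtain ⟨e, he⟩ := exists_eq_var_pow_mul k (w * h + P) fun n hn => by
    rw [Subalgebra.coe_add, map_add, hP, coeff_sum_smul_var_pow, dif_pos hn]
    simp [y]
  obtain ⟨ζ, ζ', hζ', hζt, hE⟩ := exists_euler_eq (k + 1) (e + μ • P) t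
  obtain ⟨b, hb⟩ := hw.exists_right_inv
  have hwξ : w * (b * ζ) = ζ := by rw [← mul_assoc, hb, one_mul]
  obtain ⟨ξ', hξ', -⟩ := exists_derivative_eq hw hwξ (derivative_one_add_smul_var_pow k μ) hζ'
  set y' := coeff (k + 1) ((e + μ • P : SummableSeries r) : PowerSeries ℂ)
  let v : Unknowns r k := (coeff 0 ((b * ζ : SummableSeries r) : PowerSeries ℂ), ξ', (y, y'))
  have hv : displacement r k v = b * ζ := displacement_eq hξ' _
  refine ⟨v, ?_, ?_⟩
  · refine hw.mul_left_cancel ?_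
    have hζ'' : PowerSeries.derivative ℂ (w * displacement r k v : SummableSeries r) = ζ' := by
      rw [hv, hwξ, hζ']
    rw [denom_mul_conjEqDeriv hk hwdef hX hζ'', hv, hwξ]
    change var ^ k * (var * ζ' - ((k + 1 : ℕ) : SummableSeries r) * ζ + y' • var ^ (k + 1)) -
      w * P = w * h
    have hw' : w = 1 + algebraMap ℂ (SummableSeries r) μ * var ^ k := by
      rw [hwdef, Algebra.smul_def]
    rw [hE, mul_add, ← he, Algebra.smul_def]
    linear_combination (-P) * hw'
  · rw [normalization_apply, hv, ← hwdef, hwξ, hζt]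

end Banach

/-! ### Solving the conjugacy equation by the inverse function theorem -/

section Banach

variable {r : ℝ} [hr : Fact (0 < r)] {k : ℕ} {μ : ℂ}

lemma derivative_coord (u : Unknowns r k) :
    PowerSeries.derivative ℂ (coord u : PowerSeries ℂ) = (1 + u.2.1 : SummableSeries r) := by
  rw [coord, Subalgebra.coe_add, map_add, derivative_displacement]
  simp

lemma derivative_coord_pow (u : Unknowns r k) (n : ℕ) :
    PowerSeries.derivative ℂ ((coord u ^ n : SummableSeries r) : PowerSeries ℂ) =
      ((n * coord u ^ (n - 1) * (1 + u.2.1) : SummableSeries r) : PowerSeries ℂ) := by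
  rw [Subalgebra.coe_pow, Derivation.leibniz_pow, derivative_coord]
  simp [mul_assoc]

lemma derivative_denom (u : Unknowns r k) :
    PowerSeries.derivative ℂ (denom μ u : PowerSeries ℂ) =
      ((denomDeriv μ u * (1 + u.2.1) : SummableSeries r) : PowerSeries ℂ) := by
  rw [denom, denomDeriv, smul_mul_assoc, Subalgebra.coe_add, Subalgebra.coe_smul,
    Subalgebra.coe_smul, map_add, Derivation.map_smul, derivative_coord_pow]
  simp

lemma derivative_numer (u : Unknowns r k) :
    PowerSeries.derivative ℂ (numer u : PowerSeries ℂ) =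
      ((numerDeriv u * (1 + u.2.1) : SummableSeries r) : PowerSeries ℂ) := by
  have h : ((∑ j : Fin k, u.2.2.1 j • coord u ^ (j : ℕ) : SummableSeries r) : PowerSeries ℂ) =
      ∑ j : Fin k, u.2.2.1 j • ((coord u ^ (j : ℕ) : SummableSeries r) : PowerSeries ℂ) := by
    simp
  rw [numer, Subalgebra.coe_add, map_add, derivative_coord_pow, h, map_sum]
  simp only [Derivation.map_smul, derivative_coord_pow]
  simp [numerDeriv, add_mul, Finset.sum_mul]

/-- At a solution, the vector field transported by the change of coordinate is an infinitesimal
symmetry: it lies in the kernel of the linearized equation and does not move the parameters. -/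
lemma exists_symmetry {u : Unknowns r k} {X : SummableSeries r} (h : conjEq μ (u, X) = 0)
    (hu : IsUnit (denom μ u)) :
    ∃ v : Unknowns r k, v.2.2 = 0 ∧ displacement r k v = (1 + u.2.1) * X ∧
      conjEqDeriv μ (u, X) (v, 0) = 0 := by
  have h' : denom μ u * ((1 + u.2.1) * X) = numer u := by
    rw [← mul_assoc]; exact sub_eq_zero.mp h
  obtain ⟨η', hη', hval⟩ := exists_derivative_eq hu h' (derivative_denom u) (derivative_numer u)
  refine ⟨(coeff 0 (((1 + u.2.1) * X : SummableSeries r) : PowerSeries ℂ), η', 0), rfl,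
    displacement_eq hη' 0, ?_⟩
  simp only [conjEqDeriv, displacement_eq hη' 0, Prod.fst_zero, Prod.snd_zero, zero_smul,
    Pi.zero_apply, Finset.sum_const_zero, mul_zero, add_zero, zero_add, hval]
  ring

variable (r k μ) in
/-- The conjugacy equation, completed by the normalization and by the vector field itself to a
local diffeomorphism of Banach spaces. -/
noncomputable def completed (q : Unknowns r k × SummableSeries r) :
    SummableSeries r × ℂ × SummableSeries r :=
  (conjEq μ q, normalization μ q.1, q.2)

lemma contDiff_completed : ContDiff ℂ ⊤ (completed r k μ) :=
  contDiff_conjEq.prodMk (((normalization μ).contDiff.comp contDiff_fst).prodMk contDiff_snd)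

lemma fderiv_completed (q v : Unknowns r k × SummableSeries r) :
    fderiv ℂ (completed r k μ) q v = (conjEqDeriv μ q v, normalization μ v.1, v.2) := by
  have h1 := ((contDiff_conjEq (r := r) (k := k) (μ := μ)).differentiable (by simp) q).hasFDerivAt
  have h2 := (((normalization (r := r) (k := k) μ).comp
    (ContinuousLinearMap.fst ℂ (Unknowns r k) (SummableSeries r))).prod
      (ContinuousLinearMap.snd ℂ (Unknowns r k) (SummableSeries r))).hasFDerivAt (x := q)
  have h3 : HasFDerivAt (completed r k μ) _ q := h1.prodMk h2
  rw [h3.fderiv, ← fderiv_conjEq]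
  rfl

lemma conjEqDeriv_add (q v v' : Unknowns r k × SummableSeries r) :
    conjEqDeriv μ q (v + v') = conjEqDeriv μ q v + conjEqDeriv μ q v' := by
  simp only [← fderiv_conjEq, map_add]

variable {X₀ : SummableSeries r}

lemma bijective_fderiv_completed (hk : 1 ≤ k)
    (hw : IsUnit (1 + μ • var ^ k : SummableSeries r))
    (hX : (1 + μ • var ^ k) * X₀ = var ^ (k + 1)) :
    Function.Bijective (fderiv ℂ (completed r k μ) ((0 : Unknowns r k), X₀)) := by
  constructor
  · refine (injective_iff_map_eq_zero _).mpr fun v hv => ?_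
    rw [fderiv_completed] at hv
    have h2 : v.2 = 0 := congrArg (fun p => p.2.2) hv
    have hv' : v = (v.1, 0) := Prod.ext rfl h2
    have h1 : conjEqDeriv μ ((0 : Unknowns r k), X₀) (v.1, 0) = 0 := by
      rw [← hv']; exact congrArg Prod.fst hv
    rw [hv', eq_zero_of_conjEqDeriv_eq_zero hk hw hX h1 (congrArg (fun p => p.2.1) hv)]
    rfl
  · rintro ⟨h, t, Z⟩
    obtain ⟨v, hv, ht⟩ := exists_conjEqDeriv_eq hk hw hX
      (h - conjEqDeriv μ ((0 : Unknowns r k), X₀) (0, Z)) t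
    refine ⟨(v, 0) + (0, Z), ?_⟩
    rw [fderiv_completed, conjEqDeriv_add, hv]
    simp [ht]

lemma conjEq_zero (hX : (1 + μ • var ^ k) * X₀ = var ^ (k + 1)) :
    conjEq μ ((0 : Unknowns r k), X₀) = 0 := by
  simp [conjEq, denom, numer, coord, hX]

/-- The solutions of the conjugacy equation near the identity: for every vector field `X` close
to the parabolic one there is a solution depending analytically on `X`, and all solutions for
this `X` have the same parameters. -/
theorem exists_analytic_solution (hk : 1 ≤ k)
    (hw : IsUnit (1 + μ • var ^ k : SummableSeries r))
    (hX : (1 + μ • var ^ k) * X₀ = var ^ (k + 1)) :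
    ∃ Ψ : SummableSeries r → Unknowns r k, AnalyticAt ℂ Ψ X₀ ∧ Ψ X₀ = 0 ∧
      (∀ᶠ X in 𝓝 X₀, conjEq μ (Ψ X, X) = 0) ∧
      ∀ᶠ q in 𝓝 ((0 : Unknowns r k), X₀), conjEq μ q = 0 → q.1.2.2 = (Ψ q.2).2.2 := by
  set q₀ : Unknowns r k × SummableSeries r := (0, X₀) with hq₀
  have hbij := bijective_fderiv_completed hk hw hX
  let L : (Unknowns r k × SummableSeries r) ≃L[ℂ] (SummableSeries r × ℂ × SummableSeries r) :=
    ContinuousLinearEquiv.ofBijective (fderiv ℂ (completed r k μ) q₀)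
      (LinearMap.ker_eq_bot.mpr hbij.1) (LinearMap.range_eq_top.mpr hbij.2)
  have hdiff := contDiff_completed (r := r) (k := k) (μ := μ)
  have hL : HasFDerivAt (completed r k μ) (L : _ →L[ℂ] _) q₀ := by
    rw [ContinuousLinearEquiv.coe_ofBijective]
    exact (hdiff.differentiable (by simp) q₀).hasFDerivAt
  have hH : ContDiffAt ℂ ⊤ (completed r k μ) q₀ := hdiff.contDiffAt
  have hstrict := hH.hasStrictFDerivAt' hL (by simp)
  set S := hH.localInverse hL (by simp) with hS
  have hSana : AnalyticAt ℂ S (completed r k μ q₀) := (hH.to_localInverse hL (by simp)).analyticAt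
  have hHq₀ : completed r k μ q₀ = (0, 0, X₀) := by
    simp [completed, hq₀, conjEq_zero hX]
  have hSq₀ : S (0, 0, X₀) = q₀ := by
    rw [← hHq₀]; exact hH.localInverse_apply_image hL (by simp)
  rw [hHq₀] at hSana
  have hright : ∀ᶠ p in 𝓝 ((0 : SummableSeries r), (0 : ℂ), X₀), completed r k μ (S p) = p := by
    rw [← hHq₀]; exact hstrict.eventually_right_inverse
  have hleft : ∀ᶠ q in 𝓝 q₀, S (completed r k μ q) = q := hstrict.eventually_left_inverse
  have hScont : Tendsto S (𝓝 (0, 0, X₀)) (𝓝 q₀) := by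
    have := hSana.continuousAt.tendsto
    rwa [hSq₀] at this
  have hslice : ∀ {p : SummableSeries r × ℂ × SummableSeries r}, completed r k μ (S p) = p →
      (S p).2 = p.2.2 := fun h => congrArg (fun a => a.2.2) h
  have hΨana : AnalyticAt ℂ (fun X : SummableSeries r => (S (0, 0, X)).1) X₀ :=
    analyticAt_fst.comp (hSana.comp_of_eq
      (analyticAt_const.prod (analyticAt_const.prod analyticAt_id)) rfl)
  refine ⟨fun X => (S (0, 0, X)).1, hΨana, by simp [hSq₀, hq₀], ?_, ?_⟩
  · have hc : Tendsto (fun X : SummableSeries r => ((0 : SummableSeries r), (0 : ℂ), X)) (𝓝 X₀)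
        (𝓝 (0, 0, X₀)) := (by fun_prop : Continuous _).tendsto X₀
    filter_upwards [hc.eventually hright] with X h
    have h2 : (S (0, 0, X)).2 = X := hslice h
    have h1 := congrArg Prod.fst h
    change conjEq μ (S (0, 0, X)) = 0 at h1
    rwa [← Prod.mk.eta (p := S (0, 0, X)), h2] at h1
  · -- moving the normalization moves the solution along its infinitesimal symmetry
    have hunit : ∀ᶠ q in 𝓝 q₀, IsUnit (denom μ q.1) := by
      have hcont : Continuous fun q : Unknowns r k × SummableSeries r => denom μ q.1 := by
        unfold denom coord; fun_prop
      refine hcont.continuousAt.eventually (Units.isOpen.mem_nhds ?_)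
      simpa [denom, coord, hq₀] using hw
    have hsymm : ∀ᶠ q in 𝓝 q₀, coeffL (k + 1) ((1 + μ • var ^ k) * ((1 + q.1.2.1) * q.2)) ≠ 0 := by
      have hcont : Continuous fun q : Unknowns r k × SummableSeries r =>
          coeffL (k + 1) ((1 + μ • var ^ k) * ((1 + q.1.2.1) * q.2)) := by fun_prop
      refine hcont.continuousAt.eventually (isOpen_ne.mem_nhds ?_)
      simp [hq₀, hX]
    have hgood : ∀ᶠ p in 𝓝 ((0 : SummableSeries r), (0 : ℂ), X₀),
        completed r k μ (S p) = p ∧ DifferentiableAt ℂ S p ∧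
        (∀ᶠ q in 𝓝 (S p), S (completed r k μ q) = q) ∧ IsUnit (denom μ (S p).1) ∧
        coeffL (k + 1) ((1 + μ • var ^ k) * ((1 + (S p).1.2.1) * (S p).2)) ≠ 0 :=
      hright.and ((hSana.eventually_analyticAt.mono fun p hp => hp.differentiableAt).and
        ((hScont.eventually hleft.eventually_nhds).and
          ((hScont.eventually hunit).and (hScont.eventually hsymm))))
    have hderiv : ∀ᶠ p in 𝓝 ((0 : SummableSeries r), (0 : ℂ), X₀), p.1 = 0 →
        HasDerivAt (fun s : ℂ => (S (0, s, p.2.2)).1.2.2) 0 p.2.1 := by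
      filter_upwards [hgood] with p hp hp0
      obtain ⟨hHS, hSd, hSH, hun, hne⟩ := hp
      have hp2 := hslice hHS
      have heq : conjEq μ ((S p).1, (S p).2) = 0 :=
        (congrArg Prod.fst hHS : conjEq μ (S p) = p.1).trans hp0
      obtain ⟨v, hv1, hv2, hv3⟩ := exists_symmetry heq hun
      set c := coeffL (k + 1) ((1 + μ • var ^ k) * ((1 + (S p).1.2.1) * (S p).2)) with hc
      have hτ : normalization μ v = c := by
        rw [normalization_apply, hv2]; rfl
      have hdH : fderiv ℂ (completed r k μ) (S p) (v, 0) = (0, c, 0) := by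
        rw [fderiv_completed, hτ]
        exact Prod.ext hv3 rfl
      have hcomp : HasFDerivAt (fun q => S (completed r k μ q))
          ((fderiv ℂ S p).comp (fderiv ℂ (completed r k μ) (S p))) (S p) := by
        refine HasFDerivAt.comp _ ?_ (hdiff.differentiable (by simp) _).hasFDerivAt
        rw [hHS]; exact hSd.hasFDerivAt
      have hid := hcomp.unique ((hasFDerivAt_id (S p)).congr_of_eventuallyEq hSH)
      have hdS : fderiv ℂ S p (0, c, 0) = (v, 0) := by
        rw [← hdH]; exact congrArg (fun T => T (v, 0)) hid
      have hdS1 : (fderiv ℂ S p (0, 1, 0)).1.2.2 = 0 := by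
        have : ((0 : SummableSeries r), (1 : ℂ), (0 : SummableSeries r)) = c⁻¹ • (0, c, 0) := by
          simp [hne]
        rw [this, map_smul, hdS]
        simp [hv1]
      have hline : HasDerivAt (fun s : ℂ => ((0 : SummableSeries r), s, p.2.2)) (0, 1, 0) p.2.1 :=
        (hasDerivAt_const _ _).prodMk ((hasDerivAt_id _).prodMk (hasDerivAt_const _ _))
      have hpe : p = (0, p.2.1, p.2.2) := Prod.ext hp0 rfl
      have h1 : HasDerivAt (fun s : ℂ => S (0, s, p.2.2)) (fderiv ℂ S p (0, 1, 0)) p.2.1 :=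
        HasFDerivAt.comp_hasDerivAt_of_eq _ hSd.hasFDerivAt hline hpe
      let T := (ContinuousLinearMap.snd ℂ (SummableSeries r) ((Fin k → ℂ) × ℂ)).comp
        ((ContinuousLinearMap.snd ℂ ℂ (SummableSeries r × ((Fin k → ℂ) × ℂ))).comp
          (ContinuousLinearMap.fst ℂ (Unknowns r k) (SummableSeries r)))
      have h2 := T.hasFDerivAt.comp_hasDerivAt _ h1
      exact h2.congr_deriv hdS1
    obtain ⟨ε, hε, hball⟩ := Metric.eventually_nhds_iff_ball.mp hderiv
    have hclose : ∀ᶠ q in 𝓝 q₀, completed r k μ q ∈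
        Metric.ball ((0 : SummableSeries r), (0 : ℂ), X₀) ε := by
      refine hdiff.continuous.continuousAt.eventually (Metric.isOpen_ball.mem_nhds ?_)
      rw [hHq₀]; exact Metric.mem_ball_self hε
    filter_upwards [hleft, hclose] with q hq hqε h0
    have hHq : completed r k μ q = (0, normalization μ q.1, q.2) := by
      simp only [completed, h0]
    rw [hHq] at hq hqε
    have hmem : ∀ s ∈ Metric.ball (0 : ℂ) ε,
        HasDerivAt (fun s : ℂ => (S (0, s, q.2)).1.2.2) 0 s := by
      intro s hs
      refine hball (0, s, q.2) ?_ rfl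
      simp only [Metric.mem_ball, Prod.dist_eq, max_lt_iff] at hqε hs ⊢
      exact ⟨hqε.1, hs, hqε.2.2⟩
    have hτmem : normalization μ q.1 ∈ Metric.ball (0 : ℂ) ε := by
      simp only [Metric.mem_ball, Prod.dist_eq, max_lt_iff] at hqε ⊢
      exact hqε.2.1
    have hconst := Metric.isOpen_ball.is_const_of_deriv_eq_zero
      (convex_ball (0 : ℂ) ε).isPreconnected
      (fun s hs => (hmem s hs).differentiableAt.differentiableWithinAt)
      (fun s hs => (hmem s hs).deriv) hτmem (Metric.mem_ball_self hε)
    simpa only [hq] using hconst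

end Banach

/-! ### Equivalences of germs and solutions of the conjugacy equation -/

section Germs

variable {r : ℝ} [hr : Fact (0 < r)] {k : ℕ} {μ : ℂ}

lemma eval_displacement {x : ℂ} (hx : ‖x‖ ≤ r) (u : Unknowns r k) :
    eval x (displacement r k u) = u.1 + eval x (integ u.2.1) := by
  rw [displacement_apply, ← evalHom_apply hx, map_add, AlgHom.commutes]
  rfl

lemma eval_conjEq {x : ℂ} (hx : ‖x‖ ≤ r) (u : Unknowns r k) (X : SummableSeries r) :
    eval x (conjEq μ (u, X)) =
      (1 + (μ + u.2.2.2) * (x + eval x (displacement r k u)) ^ k) * (1 + eval x u.2.1) * eval x X -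
        ((x + eval x (displacement r k u)) ^ (k + 1) +
          ∑ j : Fin k, u.2.2.1 j * (x + eval x (displacement r k u)) ^ (j : ℕ)) := by
  have hv : evalHom x hx var = x := eval_var x
  simp only [conjEq, denom, numer, coord, ← evalHom_apply hx, map_sub, map_mul, map_add, map_one,
    map_smul, map_pow, map_sum, hv, smul_eq_mul]

lemma isUnit_one_add_smul_var_pow (hk : 1 ≤ k) (h1 : r ≤ 1) (hμ : ‖μ‖ * r < 1) :
    IsUnit (1 + μ • var ^ k : SummableSeries r) := by
  have h : ‖-(μ • var ^ k : SummableSeries r)‖ < 1 := by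
    rw [norm_neg, norm_smul]
    calc ‖μ‖ * ‖(var ^ k : SummableSeries r)‖ ≤ ‖μ‖ * r ^ k := by
          gcongr
          exact (norm_pow_le _ _).trans_eq (by rw [norm_var])
      _ ≤ ‖μ‖ * r := by
          gcongr
          exact pow_le_of_le_one hr.out.le h1 (by omega)
      _ < 1 := hμ
  simpa using isUnit_one_sub_of_norm_lt_one h

/-- An element of `SummableSeries r` with the values of the parabolic normal form near `0`
satisfies the defining equation of the latter. -/
lemma mul_eq_var_pow_of_eval_eq (hw : IsUnit (1 + μ • var ^ k : SummableSeries r))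
    {X₀ : SummableSeries r} (h : ∀ᶠ x in 𝓝 (0 : ℂ), eval x X₀ = parabolic k μ x) :
    (1 + μ • var ^ k) * X₀ = var ^ (k + 1) := by
  refine ext_of_eval ?_
  filter_upwards [h, eventually_norm_le (r := r)] with x hx hxr
  have hv : evalHom x hxr var = x := eval_var x
  have hne := (hw.map (evalHom x hxr)).ne_zero
  simp only [map_add, map_one, map_smul, map_pow, hv, smul_eq_mul] at hne
  rw [← evalHom_apply hxr, ← evalHom_apply hxr, map_mul, evalHom_apply hxr X₀, hx]
  simp only [map_add, map_one, map_smul, map_pow, hv, smul_eq_mul, parabolic]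
  field_simp

variable {m : ℕ}

lemma eventually_denominator_ne_zero (hk : 1 ≤ k) {φ : ℂ × (Fin m → ℂ) → ℂ}
    {ψ : (Fin m → ℂ) → (Fin k → ℂ) × ℂ} (hφ : ContinuousAt φ 0) (hφ0 : φ 0 = 0)
    (hψ : ContinuousAt ψ 0) :
    ∀ᶠ p in 𝓝 (0 : ℂ × (Fin m → ℂ)), 1 + (μ + (ψ p.2).2) * φ p ^ k ≠ 0 := by
  have h1 : ContinuousAt (fun p : ℂ × (Fin m → ℂ) => ψ p.2) 0 :=
    ContinuousAt.comp (g := ψ) (f := Prod.snd) hψ continuousAt_snd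
  have h2 : ContinuousAt (fun p : ℂ × (Fin m → ℂ) => 1 + (μ + (ψ p.2).2) * φ p ^ k) 0 := by
    fun_prop
  refine h2.eventually_ne ?_
  rw [hφ0, zero_pow (by omega)]
  simp

/-- An equivalence of a deformation with an induced family solves the conjugacy equation in
`SummableSeries r`, for every small radius `r`. -/
lemma exists_solution_of_isInducingMap (hk : 1 ≤ k) {X : ℂ × (Fin m → ℂ) → ℂ}
    {ψ : (Fin m → ℂ) → (Fin k → ℂ) × ℂ} (h : IsInducingMap X (kostovFamily k μ) ψ) :
    ∃ r₀ : ℝ, 0 < r₀ ∧ ∀ (r : ℝ) [Fact (0 < r)], r < r₀ →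
      ∀ F : (Fin m → ℂ) → SummableSeries r,
        (∀ᶠ l in 𝓝 0, ∀ x : ℂ, ‖x‖ ≤ r → eval x (F l) = X (x, l)) →
        ∃ u : (Fin m → ℂ) → Unknowns r k, Tendsto u (𝓝 0) (𝓝 0) ∧
          ∀ᶠ l in 𝓝 0, conjEq μ (u l, F l) = 0 ∧ (u l).2.2 = ψ l := by
  obtain ⟨hψ, hψ0, φ, hφ, hφid⟩ := h
  have hΦ : AnalyticAt ℂ (fun p => fderiv ℂ φ p (1, 0) - 1) 0 :=
    (((ContinuousLinearMap.apply ℂ ℂ ((1 : ℂ), (0 : Fin m → ℂ))).analyticAt _).comp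
      hφ.analyticAt.fderiv).sub analyticAt_const
  obtain ⟨r₀, hr₀, hF⟩ := exists_analyticAt_eval_eq hΦ
  refine ⟨r₀, hr₀, fun r hr hlt F hFX => ?_⟩
  obtain ⟨g, hg, hgΦ⟩ := hF r hlt
  -- partial derivatives with respect to `x`
  have hpartial : ∀ {p : ℂ × (Fin m → ℂ)}, DifferentiableAt ℂ φ p →
      HasDerivAt (fun x => φ (x, p.2)) (fderiv ℂ φ p (1, 0)) p.1 := by
    intro p hp
    exact HasFDerivAt.comp_hasDerivAt_of_eq _ hp.hasFDerivAt
      ((hasDerivAt_id _).prodMk (hasDerivAt_const _ _)) rfl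
  have hdiff : ∀ᶠ p in 𝓝 (0 : ℂ × (Fin m → ℂ)), DifferentiableAt ℂ φ p :=
    hφ.analyticAt.eventually_analyticAt.mono fun p hp => hp.differentiableAt
  have hxr : ∀ᶠ p in 𝓝 (0 : ℂ × (Fin m → ℂ)), ‖p.1‖ < r := by
    have : ContinuousAt (fun p : ℂ × (Fin m → ℂ) => ‖p.1‖) 0 := by fun_prop
    exact this.eventually (gt_mem_nhds (by simpa using hr.out))
  have hall := hdiff.and (hxr.and (hφ.pullback_eq.and (eventually_denominator_ne_zero (μ := μ) hk
    hφ.analyticAt.continuousAt hφ.map_zero hψ.continuousAt)))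
  obtain ⟨ρ, hρ, hball⟩ := Metric.eventually_nhds_iff_ball.mp hall
  have hmem : ∀ {x : ℂ} {l : Fin m → ℂ}, x ∈ Metric.ball (0 : ℂ) ρ →
      l ∈ Metric.ball (0 : Fin m → ℂ) ρ → (x, l) ∈ Metric.ball (0 : ℂ × (Fin m → ℂ)) ρ := by
    intro x l hx hl
    rw [mem_ball_zero_iff] at hx hl ⊢
    exact (Prod.norm_def _).trans_lt (max_lt hx hl)
  have hg0 : g 0 = 0 := by
    refine ext_of_eval ?_
    filter_upwards [hφid.eventually_nhds, Metric.ball_mem_nhds (0 : ℂ) hρ,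
      eventually_norm_le (r := r)] with x hx hxρ hxr
    have h1 := hpartial (hball _ (hmem hxρ (Metric.mem_ball_self hρ))).1
    have h2 : HasDerivAt (fun x => φ (x, 0)) 1 x := (hasDerivAt_id x).congr_of_eventuallyEq hx
    rw [hgΦ.self_of_nhds x hxr, h1.unique h2, ← evalHom_apply hxr, map_zero, sub_self]
  let u : (Fin m → ℂ) → Unknowns r k := fun l => (φ (0, l), g l, ψ l)
  have hu : ContinuousAt u 0 := by
    have h1 : ContinuousAt (fun l : Fin m → ℂ => φ (0, l)) 0 :=
      ContinuousAt.comp_of_eq (g := φ) hφ.analyticAt.continuousAt (by fun_prop) rfl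
    exact h1.prodMk (hg.continuousAt.prodMk hψ.continuousAt)
  have hu0 : u 0 = 0 := Prod.ext hφ.map_zero (Prod.ext hg0 hψ0)
  refine ⟨u, by simpa only [hu0] using hu.tendsto, ?_⟩
  filter_upwards [hFX, hgΦ, Metric.ball_mem_nhds (0 : Fin m → ℂ) hρ] with l hlX hlΦ hl
  refine ⟨ext_of_eval ?_, rfl⟩
  filter_upwards [Metric.ball_mem_nhds (0 : ℂ) hρ] with x hx
  -- `φ(x; l)` and `x + c + ∫₀ˣ g` have the same derivative and the same value at `0`
  have hder : ∀ z ∈ Metric.ball (0 : ℂ) ρ,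
      HasDerivAt (fun z => φ (z, l) - z - eval z (integ (g l))) 0 z := by
    intro z hz
    have h1 := hball _ (hmem hz hl)
    have h2 := ((hpartial h1.1).sub (hasDerivAt_id z)).sub (hasDerivAt_eval_integ (g l) h1.2.1)
    refine h2.congr_deriv ?_
    rw [hlΦ z h1.2.1.le, sub_self]
  have hconst := Metric.isOpen_ball.is_const_of_deriv_eq_zero
    (convex_ball (0 : ℂ) ρ).isPreconnected
    (fun s hs => (hder s hs).differentiableAt.differentiableWithinAt)
    (fun s hs => (hder s hs).deriv) hx (Metric.mem_ball_self hρ)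
  obtain ⟨hd, hxr, hpull, hne⟩ := hball _ (hmem hx hl)
  have hcoord : x + eval x (displacement r k (u l)) = φ (x, l) := by
    rw [eval_displacement hxr.le]
    simp only [eval_zero_left, coeff_zero_integ] at hconst
    change x + (φ (0, l) + eval x (integ (g l))) = φ (x, l)
    linear_combination -hconst
  rw [(hpartial hd).deriv] at hpull
  simp only [induced, kostovFamily] at hpull
  rw [eq_div_iff hne] at hpull
  rw [eval_conjEq hxr.le, hcoord, hlX x hxr.le, ← evalHom_apply hxr.le 0, map_zero]
  change (1 + (μ + (ψ l).2) * φ (x, l) ^ k) * (1 + eval x (g l)) * X (x, l) -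
    (φ (x, l) ^ (k + 1) + ∑ j, (ψ l).1 j * φ (x, l) ^ (j : ℕ)) = 0
  rw [← hpull, hlΦ x hxr.le]
  ring

/-- A small radius for which `1 + μ x ^ k` is invertible. -/
lemma exists_small_radius (μ : ℂ) {r₀ : ℝ} (hr₀ : 0 < r₀) :
    ∃ r : ℝ, 0 < r ∧ r < r₀ ∧ r ≤ 1 ∧ ‖μ‖ * r < 1 := by
  have hμ : 0 < ‖μ‖ + 1 := by positivity
  refine ⟨min (r₀ / 2) (‖μ‖ + 1)⁻¹, by positivity, (min_le_left _ _).trans_lt (by linarith),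
    (min_le_right _ _).trans (inv_le_one_of_one_le₀ (by linarith [norm_nonneg μ])), ?_⟩
  calc ‖μ‖ * min (r₀ / 2) (‖μ‖ + 1)⁻¹ ≤ ‖μ‖ * (‖μ‖ + 1)⁻¹ := by
        gcongr; exact min_le_right _ _
    _ < 1 := by rw [mul_inv_lt_iff₀ hμ]; linarith

lemma isDeformation_kostovFamily (hk : 1 ≤ k) (μ : ℂ) :
    IsDeformation (kostovFamily k μ) (parabolic k μ) := by
  refine ⟨?_, .of_forall fun x => by simp [kostovFamily, parabolic]⟩
  have hne : (1 + (μ + (0 : ℂ × ((Fin k → ℂ) × ℂ)).2.2) *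
      (0 : ℂ × ((Fin k → ℂ) × ℂ)).1 ^ k) ≠ 0 := by
    simp [show k ≠ 0 by omega]
  have hx : AnalyticAt ℂ (fun p : ℂ × ((Fin k → ℂ) × ℂ) => p.1) 0 := analyticAt_fst
  have hy' : AnalyticAt ℂ (fun p : ℂ × ((Fin k → ℂ) × ℂ) => p.2.2) 0 :=
    ((ContinuousLinearMap.snd ℂ (Fin k → ℂ) ℂ).comp
      (ContinuousLinearMap.snd ℂ ℂ ((Fin k → ℂ) × ℂ))).analyticAt _
  have hy : ∀ j, AnalyticAt ℂ (fun p : ℂ × ((Fin k → ℂ) × ℂ) => p.2.1 j) 0 := fun j =>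
    ((ContinuousLinearMap.proj (R := ℂ) (φ := fun _ : Fin k => ℂ) j).comp
      ((ContinuousLinearMap.fst ℂ (Fin k → ℂ) ℂ).comp
        (ContinuousLinearMap.snd ℂ ℂ ((Fin k → ℂ) × ℂ)))).analyticAt _
  exact ((hx.pow _).add (Finset.analyticAt_fun_sum _ fun j _ => (hy j).mul (hx.pow _))).div
    (analyticAt_const.add ((analyticAt_const.add hy').mul (hx.pow k))) hne

/-- Versality: the normalized solution of the conjugacy equation for the fields `X(·; l)` is
analytic in `l`, and so are the change of coordinate and the inducing map read off from it. -/
theorem exists_isInducingMap (hk : 1 ≤ k) {X : ℂ × (Fin m → ℂ) → ℂ}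
    (hX : IsDeformation X (parabolic k μ)) :
    ∃ ψ : (Fin m → ℂ) → (Fin k → ℂ) × ℂ, IsInducingMap X (kostovFamily k μ) ψ := by
  obtain ⟨r₀, hr₀, hF⟩ := exists_analyticAt_eval_eq hX.1
  obtain ⟨r, hr, hrr₀, hr1, hrμ⟩ := exists_small_radius μ hr₀
  have : Fact (0 < r) := ⟨hr⟩
  obtain ⟨F, hFa, hFX⟩ := hF r hrr₀
  have hw := isUnit_one_add_smul_var_pow hk hr1 hrμ
  have hX₀ := mul_eq_var_pow_of_eval_eq (X₀ := F 0) hw (by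
    filter_upwards [hX.2, eventually_norm_le (r := r)] with x hx hxr
    rw [hFX.self_of_nhds x hxr, hx])
  obtain ⟨Ψ, hΨ, hΨ0, hsol, -⟩ := exists_analytic_solution hk hw hX₀
  have hu : AnalyticAt ℂ (fun l => Ψ (F l)) 0 := hΨ.comp_of_eq hFa rfl
  let φ : ℂ × (Fin m → ℂ) → ℂ := fun p => p.1 + eval p.1 (displacement r k (Ψ (F p.2)))
  have hψ : AnalyticAt ℂ (fun l => (Ψ (F l)).2.2) 0 :=
    (((ContinuousLinearMap.snd ℂ (SummableSeries r) ((Fin k → ℂ) × ℂ)).comp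
      (ContinuousLinearMap.snd ℂ ℂ _)).analyticAt _).comp hu
  have hφ : AnalyticAt ℂ φ 0 := by
    have h1 : AnalyticAt ℂ (fun p : ℂ × (Fin m → ℂ) => displacement r k (Ψ (F p.2))) 0 :=
      ((displacement r k).analyticAt _).comp (hu.comp_of_eq analyticAt_snd rfl)
    exact analyticAt_fst.add
      ((analyticAt_eval (displacement r k (Ψ (F 0)))).comp_of_eq (analyticAt_fst.prod h1) rfl)
  have hφid : ∀ x : ℂ, φ (x, 0) = x := fun x => by
    simp [φ, hΨ0, eval]
  have hφ0 : φ 0 = 0 := hφid 0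
  refine ⟨fun l => (Ψ (F l)).2.2, hψ, by simp [hΨ0], φ, ⟨hφ, hφ0, ?_, ?_⟩, .of_forall hφid⟩
  · simp [hφid]
  · have hl : ∀ᶠ p in 𝓝 (0 : ℂ × (Fin m → ℂ)), conjEq μ (Ψ (F p.2), F p.2) = 0 ∧
        ∀ x : ℂ, ‖x‖ ≤ r → eval x (F p.2) = X (x, p.2) :=
      (continuous_snd.tendsto' (0 : ℂ × (Fin m → ℂ)) 0 rfl).eventually
        ((hFa.continuousAt.eventually hsol).and hFX)
    have hx : ∀ᶠ p in 𝓝 (0 : ℂ × (Fin m → ℂ)), ‖p.1‖ < r := by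
      have : ContinuousAt (fun p : ℂ × (Fin m → ℂ) => ‖p.1‖) 0 := by fun_prop
      exact this.eventually (gt_mem_nhds (by simpa using hr))
    filter_upwards [hl, hx, eventually_denominator_ne_zero (μ := μ) hk hφ.continuousAt hφ0
      hψ.continuousAt] with p hp hpr hne
    have hd : HasDerivAt (fun x : ℂ => φ (x, p.2)) (1 + eval p.1 (Ψ (F p.2)).2.1) p.1 := by
      have h1 := (hasDerivAt_id p.1).add
        ((hasDerivAt_eval_integ (Ψ (F p.2)).2.1 hpr).const_add (Ψ (F p.2)).1)
      refine h1.congr_of_eventuallyEq ?_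
      filter_upwards [continuous_norm.continuousAt.eventually (gt_mem_nhds hpr)] with x hx
      simp only [φ]
      rw [eval_displacement hx.le]
      rfl
    have heq := eval_conjEq (μ := μ) hpr.le (Ψ (F p.2)) (F p.2)
    rw [hp.1, ← evalHom_apply hpr.le 0, map_zero, hp.2 _ hpr.le] at heq
    rw [hd.deriv]
    simp only [induced, kostovFamily]
    rw [eq_div_iff hne]
    simp only [φ]
    linear_combination -heq

/-- Uniqueness: both inducing maps are the parameters of solutions of the conjugacy equation close
to the identity, for the same fields `X(·; l)`. -/
theorem eventuallyEq_of_isInducingMap (hk : 1 ≤ k) {X : ℂ × (Fin m → ℂ) → ℂ}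
    (hX : IsDeformation X (parabolic k μ)) {ψ₁ ψ₂ : (Fin m → ℂ) → (Fin k → ℂ) × ℂ}
    (h₁ : IsInducingMap X (kostovFamily k μ) ψ₁) (h₂ : IsInducingMap X (kostovFamily k μ) ψ₂) :
    ψ₁ =ᶠ[𝓝 0] ψ₂ := by
  obtain ⟨r₀, hr₀, hF⟩ := exists_analyticAt_eval_eq hX.1
  obtain ⟨r₁, hr₁, hs₁⟩ := exists_solution_of_isInducingMap hk h₁
  obtain ⟨r₂, hr₂, hs₂⟩ := exists_solution_of_isInducingMap hk h₂
  obtain ⟨r, hr, hrlt, hr1, hrμ⟩ := exists_small_radius μ (lt_min hr₀ (lt_min hr₁ hr₂))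
  rw [lt_min_iff, lt_min_iff] at hrlt
  have : Fact (0 < r) := ⟨hr⟩
  obtain ⟨F, hFa, hFX⟩ := hF r hrlt.1
  have hw := isUnit_one_add_smul_var_pow hk hr1 hrμ
  have hX₀ := mul_eq_var_pow_of_eval_eq (X₀ := F 0) hw (by
    filter_upwards [hX.2, eventually_norm_le (r := r)] with x hx hxr
    rw [hFX.self_of_nhds x hxr, hx])
  obtain ⟨Ψ, -, -, -, huniq⟩ := exists_analytic_solution hk hw hX₀
  obtain ⟨u₁, hu₁, he₁⟩ := hs₁ r hrlt.2.1 F hFX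
  obtain ⟨u₂, hu₂, he₂⟩ := hs₂ r hrlt.2.2 F hFX
  have hFt : Tendsto F (𝓝 0) (𝓝 (F 0)) := hFa.continuousAt
  filter_upwards [(hu₁.prodMk_nhds hFt).eventually huniq, (hu₂.prodMk_nhds hFt).eventually huniq,
    he₁, he₂] with l q₁ q₂ e₁ e₂
  rw [← e₁.2, ← e₂.2]
  exact (q₁ e₁.1).trans (q₂ e₂.1).symm

end Germs
end VectorFieldGerm

theorem theorem1 (k : ℕ) (hk : 1 ≤ k) (μ : ℂ) :
    VectorFieldGerm.IsUniversal (VectorFieldGerm.kostovFamily k μ)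
      (VectorFieldGerm.parabolic k μ) :=
  ⟨⟨VectorFieldGerm.isDeformation_kostovFamily hk μ,
    fun _ _ hX => VectorFieldGerm.exists_isInducingMap hk hX⟩,
    fun _ _ hX _ _ h₁ h₂ => VectorFieldGerm.eventuallyEq_of_isInducingMap hk hX h₁ h₂⟩
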